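/- Conventions. For $d\ge 3$ let $T_d$ be the $d$-regular tree; $\mathrm{Aut}(T_d)$ carries the topology of pointwise convergence on vertices. A regular legal coloring is a map $c$ from the directed edges of $T_d$ to a set $[d]$ of $d$ colors such that $c(e)=c(\bar e)$ for every directed edge $e$ and, for every vertex $v$, the restriction $c_v$ of $c$ to the set of edges with origin $v$ is a bijection onto $[d]$. For $F\le \mathrm{Sym}(d)$, the Burger--Mozes universal group is $$U(F)=U_c(F)=\{g\in\mathrm{Aut}(T_d) : c_{g(v)}\circ g\circ c_v^{-1}\in F \text{ for every vertex } v\},$$ where $c$ is any regular legal coloring. For a subgroup $G\le \mathrm{Aut}(T_d)$, $G^+$ denotes the subgroup generated by the pointwise fixators in $G$ of the edges. A permutation group acts freely if all its point stabilizers are trivial. A Frobenius group is a transitive permutation group of a finite set that does not act freely but in which the stabilizer of any two distinct points is trivial. Isomorphisms of topological groups are simultaneously homeomorphisms, and topologically simple means nontrivial with no closed normal subgroups other than the trivial one and the whole group. Theorem. Let $F\le \mathrm{Sym}(d)$ be a permutation group that does not act freely (so $d\ge 3$). Then $U(F)$ contains a compactly generated closed subgroup $H$ with a discrete normal subgroup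 $D$ such that $H/D$ is a non-discrete, totally disconnected, locally compact, compactly generated group that is simple as an abstract group, hence topologically simple, and such that $H/D$ is isomorphic to $\mathrm{Aut}(T_3)^+$ or to $U(F')^+$ for some Frobenius group $F'$. More precisely: (1) if $2$ divides the order of some point stabilizer of $F$, then $H$ and $D$ with these properties can be chosen such that $H/D\cong \mathrm{Aut}(T_3)^+$; (2) if an odd prime $p$ divides the order of some point stabilizer of $F$ and $F'\le \mathrm{Sym}(n)$ is any Frobenius group whose point stabilizers have order $p$ and index a power of two, then $H$ and $D$ with these properties can be chosen such that $H/D\cong U(F')^+$. -/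

import Mathlib

namespace BurgerMozes

universe u

/-! ### Automorphism groups of trees

A tree is a `SimpleGraph` satisfying `SimpleGraph.IsTree`. Its directed edges are its darts, edge
reversal is `SimpleGraph.Dart.symm`, and the directed edges with origin `v` are the neighbours of
`v`. The automorphism group of `T` is `T ≃g T`. -/

/-- The topology of pointwise convergence on the automorphism group of a graph, the vertex set
being discrete. A directed edge is determined by its endpoints, so this is also pointwise
convergence on vertices and directed edges. -/
instance autTopology {V : Type u} (T : SimpleGraph V) : TopologicalSpace (T ≃g T) :=
  TopologicalSpace.induced (fun g : T ≃g T => (g : V → V))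
    (@Pi.topologicalSpace V (fun _ => V) (fun _ => ⊥))

/-- The graph is `d`-regular. -/
def IsRegular {V : Type u} (T : SimpleGraph V) (d : ℕ) : Prop :=
  ∀ v, Nat.card (T.neighborSet v) = d

/-- `G⁺`, the subgroup generated by the pointwise fixators in `G` of the edges. -/
def plus {V : Type u} {T : SimpleGraph V} (G : Subgroup (T ≃g T)) : Subgroup (T ≃g T) :=
  Subgroup.closure {g | g ∈ G ∧ ∃ v w, T.Adj v w ∧ g v = v ∧ g w = w}

/-- A regular coloring of degree `d`: a map from the directed edges to `Fin d` whose restriction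
`c_v` to the set of edges with origin `v` is a bijection for every vertex `v`. -/
structure RegularColoring {V : Type u} (T : SimpleGraph V) (d : ℕ) where
  /-- the color of a directed edge -/
  color : T.Dart → Fin d
  bijective : ∀ v : V, Function.Bijective
    (fun w : T.neighborSet v => color ⟨(v, w.1), w.2⟩)

namespace RegularColoring

variable {V : Type u} {T : SimpleGraph V} {d : ℕ}

/-- A coloring is legal if an edge and its reverse have the same color. -/
def IsLegal (c : RegularColoring T d) : Prop :=
  ∀ e : T.Dart, c.color e.symm = c.color e

/-- The bijection `c_v` from the edges with origin `v` to the colors. -/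
noncomputable def atVertex (c : RegularColoring T d) (v : V) : T.neighborSet v ≃ Fin d :=
  Equiv.ofBijective _ (c.bijective v)

/-- The local action `σ_c(g, v) = c_{gv} ∘ g ∘ c_v⁻¹`. -/
noncomputable def localAction (c : RegularColoring T d) (g : T ≃g T) (v : V) :
    Equiv.Perm (Fin d) :=
  ((c.atVertex v).symm.trans (g.mapNeighborSet v)).trans (c.atVertex (g v))

theorem localAction_one (c : RegularColoring T d) (v : V) : c.localAction 1 v = 1 := by
  ext i
  have h : (SimpleGraph.Iso.mapNeighborSet (1 : T ≃g T) v) ((c.atVertex v).symm i)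
      = (c.atVertex v).symm i := rfl
  simp only [localAction, Equiv.trans_apply, Equiv.Perm.one_apply]
  rw [h]
  exact congrArg Fin.val ((c.atVertex v).apply_symm_apply i)

theorem localAction_mul (c : RegularColoring T d) (g h : T ≃g T) (v : V) :
    c.localAction (g * h) v = c.localAction g (h v) * c.localAction h v := by
  ext i
  simp only [localAction, Equiv.trans_apply, Equiv.Perm.mul_apply, Equiv.symm_apply_apply]
  rfl

end RegularColoring

/-- The Burger–Mozes group `U_c(F)`: all automorphisms whose local action at every vertex is
in `F`. -/
def universalGroup {V : Type u} {T : SimpleGraph V} {d : ℕ} (c : RegularColoring T d)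
    (F : Subgroup (Equiv.Perm (Fin d))) : Subgroup (T ≃g T) where
  carrier := {g | ∀ v, c.localAction g v ∈ F}
  one_mem' v := by
    rw [c.localAction_one]
    exact F.one_mem
  mul_mem' {g h} hg hh v := by
    rw [c.localAction_mul]
    exact F.mul_mem (hg _) (hh _)
  inv_mem' {g} hg v := by
    have h1 := c.localAction_mul g g⁻¹ v
    rw [mul_inv_cancel, c.localAction_one] at h1
    rw [eq_inv_of_mul_eq_one_right h1.symm]
    exact F.inv_mem (hg _)

/-! ### Permutation groups -/

/-- A permutation group acts freely if all its point stabilizers are trivial. -/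
def ActsFreely {n : ℕ} (F : Subgroup (Equiv.Perm (Fin n))) : Prop :=
  ∀ i : Fin n, MulAction.stabilizer F i = ⊥

/-- A Frobenius group: a transitive permutation group that does not act freely, but in which the
stabilizer of every ordered pair of distinct points is trivial. -/
structure IsFrobenius {n : ℕ} (F : Subgroup (Equiv.Perm (Fin n))) : Prop where
  transitive : MulAction.IsPretransitive F (Fin n)
  not_free : ¬ ActsFreely F
  two_point : ∀ i j : Fin n, i ≠ j → MulAction.stabilizer F i ⊓ MulAction.stabilizer F j = ⊥

/-! ### Topological groups -/

/-- A topological group is compactly generated if some compact subset generates it. -/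
def IsCompactlyGenerated (G : Type u) [Group G] [TopologicalSpace G] : Prop :=
  ∃ K : Set G, IsCompact K ∧ Subgroup.closure K = ⊤

/-- A nontrivial group whose only closed normal subgroups are the trivial one and itself. -/
def IsTopologicallySimple (G : Type u) [Group G] [TopologicalSpace G] : Prop :=
  Nontrivial G ∧ ∀ N : Subgroup G, N.Normal → IsClosed (N : Set G) → N = ⊥ ∨ N = ⊤

/-- The class `𝒮` of non-discrete totally disconnected locally compact (Hausdorff) groups that are
topologically simple and compactly generated. -/
structure InClassS (G : Type u) [Group G] [TopologicalSpace G] : Prop where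
  isTopologicalGroup : IsTopologicalGroup G
  t2 : T2Space G
  locallyCompact : LocallyCompactSpace G
  totallyDisconnected : TotallyDisconnectedSpace G
  not_discrete : ¬ DiscreteTopology G
  compactlyGenerated : IsCompactlyGenerated G
  topologicallySimple : IsTopologicallySimple G

/-- `H` is a compactly generated closed subgroup contained in `U`, `D` is a discrete normal
subgroup of `H`, and `H / D` is simple (also as an abstract group) and belongs to `𝒮`. -/
structure IsSimpleSubquotient {G : Type u} [Group G] [TopologicalSpace G] (U H : Subgroup G)
    (D : Subgroup H) [D.Normal] : Prop where
  le : H ≤ U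
  isClosed : IsClosed (H : Set G)
  compactlyGenerated : IsCompactlyGenerated H
  discrete : DiscreteTopology D
  simple : IsSimpleGroup (H ⧸ D)
  inClassS : InClassS (H ⧸ D)

end BurgerMozes

/-! By Cauchy, a point stabilizer of order divisible by a prime `p` contains some σ in `F` of order
`p` that fixes a color `a`. Everything is done inside the cyclic group generated by σ.

Covering argument. Let G = U(F')⁺ act on a connected d-regular graph X whose colored edges are given
by d involutions, such that each g permutes the colors at each point by a power of σ. The tree T is
the universal cover of X. Let H be the group of all lifts of elements of G to T. The local actions
of a lift are the color permutations of the element below it, so H lies in U(F). The kernel D of H →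
G consists of deck transformations; these have trivial local actions, so one that fixes a vertex is
trivial, and D is discrete. Finally H/D ≅ G.

Construction of X. A point is a directed edge of the tree of F' together with a position on a cycle
of length 2(M+1). Color `a` advances along the cycle and reverses the edge once per round. Every
other color j joins the two sides of a level y by a permutation R_{y,j} of the edges at a vertex.
Equivariance demands R_{y,χ(f)j} = f R_{y,j} f⁻¹, where χ maps F' onto ⟨σ⟩ with the Frobenius kernel
Q as its kernel. It is achieved by conjugating an element ζ of the centralizer Z of Q. Connectedness
holds because going along color σ(o) and back along color o acts as ζ⁻¹gζg⁻¹, where χ(g) = σ. Since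
g commutes with no nontrivial element of Z, these commutators exhaust Z, which is transitive; M+1
levels are enough to realize all of its elements.

Simplicity of G is Tits' argument. A nontrivial normal subgroup contains some m whose powers move a
half-tree off itself, and every element supported on that half-tree is a commutator of m with an
infinite product of its conjugates. The fixator of an edge is the product of its parts on the two
half-trees.

For `p = 2` one takes F' = Sym(3), as U(Sym(3)) = Aut(T₃). -/

namespace BurgerMozes
universe u

/-! ### Distances and half-trees in a tree -/

section Tree

variable {V : Type u} {T : SimpleGraph V}

/-- A property that spreads along edges holds everywhere in a connected graph. -/
theorem forall_of_adj (hT : T.Connected) {P : V → Prop} (t : V) (h0 : P t)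
    (hP : ∀ v w, T.Adj v w → P v → P w) (v : V) : P v := by
  obtain ⟨p⟩ := hT t v
  induction p with
  | nil => exact h0
  | cons h p ih => exact ih (hP _ _ h h0)

/-- A neighbour closer to `u` is the second vertex of a geodesic from `w` to `u`, and paths in a
tree are unique. -/
theorem eq_of_dist_lt (hT : T.IsTree) {u w x y : V} (hx : T.Adj w x) (hy : T.Adj w y)
    (hxu : T.dist x u < T.dist w u) (hyu : T.dist y u < T.dist w u) : x = y := by
  have key : ∀ {z} (hz : T.Adj w z), T.dist z u < T.dist w u →
      ∃ p : T.Walk w u, p.IsPath ∧ p.snd = z := by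
    intro z hz hzu
    obtain ⟨p, hp⟩ := hT.connected.exists_walk_length_eq_dist z u
    refine ⟨.cons hz p, SimpleGraph.Walk.isPath_of_length_eq_dist _ ?_, by simp⟩
    have := hT.connected.dist_triangle (u := w) (v := z) (w := u)
    have h1 : T.dist w z = 1 := SimpleGraph.dist_eq_one_iff_adj.2 hz
    simp only [SimpleGraph.Walk.length_cons]
    omega
  obtain ⟨p, hp, rfl⟩ := key hx hxu
  obtain ⟨q, hq, rfl⟩ := key hy hyu
  rw [(hT.existsUnique_path w u).unique hp hq]

theorem exists_adj_dist_lt (hT : T.IsTree) {u w : V} (h : w ≠ u) :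
    ∃ x, T.Adj w x ∧ T.dist w u = T.dist x u + 1 := by
  obtain ⟨p, hp⟩ := hT.connected.exists_walk_length_eq_dist w u
  cases p with
  | nil => exact absurd rfl h
  | @cons _ x _ hx q =>
    refine ⟨x, hx, ?_⟩
    have := SimpleGraph.dist_le q
    have h1 : T.dist w x = 1 := SimpleGraph.dist_eq_one_iff_adj.2 hx
    have := hT.connected.dist_triangle (u := w) (v := x) (w := u)
    simp only [SimpleGraph.Walk.length_cons] at hp
    omega

theorem dist_adj_cases (hT : T.IsTree) (u : V) {v w : V} (h : T.Adj v w) :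
    T.dist v u = T.dist w u + 1 ∨ T.dist w u = T.dist v u + 1 := by
  have := hT.dist_eq_dist_add_one_of_adj u h
  rw [T.dist_comm (u := v), T.dist_comm (u := w)]
  omega

/-- Recursion on a tree along the distance from a root. -/
theorem exists_tree_rec (hT : T.IsTree) (t : V) {X : Type*} (x : X) (κ : V → V → X → X) :
    ∃ π : V → X, π t = x ∧
      ∀ v w, T.Adj v w → T.dist w t = T.dist v t + 1 → π w = κ v w (π v) := by
  classical
  have hpar : ∀ w, ∃ v, w ≠ t → T.Adj w v ∧ T.dist w t = T.dist v t + 1 := by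
    intro w
    by_cases h : w = t
    · exact ⟨w, fun h' => absurd h h'⟩
    · obtain ⟨v, hv⟩ := exists_adj_dist_lt hT h
      exact ⟨v, fun _ => hv⟩
  choose par hpar using hpar
  -- `F k v` unfolds `k` recursion steps from `v` towards the root; it is only used with `k` the
  -- distance to the root.
  let F : ℕ → V → X := fun n => Nat.rec (fun _ => x) (fun _ f v => κ (par v) v (f (par v))) n
  refine ⟨fun v => F (T.dist v t) v, by simp [F], fun v w hvw hd => ?_⟩
  have hw : w ≠ t := by
    rintro rfl
    simp at hd
  have hp : par w = v := eq_of_dist_lt hT (u := t) (hpar w hw).1 hvw.symm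
    (by have := (hpar w hw).2; omega) (by omega)
  simp only [hd]
  change κ (par w) w (F (T.dist v t) (par w)) = _
  rw [hp]

/-- The half-tree at the end of the directed edge from `v` to `w`. -/
def halfTree (T : SimpleGraph V) (v w : V) : Set V := {u | T.dist w u < T.dist v u}

theorem mem_halfTree {v w u : V} : u ∈ halfTree T v w ↔ T.dist w u < T.dist v u := Iff.rfl

theorem target_mem_halfTree {v w : V} (h : T.Adj v w) : w ∈ halfTree T v w := by
  rw [mem_halfTree, SimpleGraph.dist_self, SimpleGraph.dist_eq_one_iff_adj.2 h]
  exact one_pos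

theorem source_notMem_halfTree (v w : V) : v ∉ halfTree T v w := by
  simp [mem_halfTree]

theorem notMem_halfTree_iff (hT : T.IsTree) {v w : V} (h : T.Adj v w) {u : V} :
    u ∉ halfTree T v w ↔ u ∈ halfTree T w v := by
  have := dist_adj_cases hT u h
  simp only [mem_halfTree]
  omega

theorem dist_apply (g : T ≃g T) (hT : T.Connected) (u v : V) :
    T.dist (g u) (g v) = T.dist u v := by
  have key : ∀ (g : T ≃g T) u v, T.dist (g u) (g v) ≤ T.dist u v := by
    intro g u v
    obtain ⟨p, hp⟩ := hT.exists_walk_length_eq_dist u v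
    have := SimpleGraph.dist_le (p.map (g : T →g T))
    rw [SimpleGraph.Walk.length_map, hp] at this
    exact this
  refine le_antisymm (key g u v) ?_
  have := key g.symm (g u) (g v)
  simpa using this

theorem apply_mem_halfTree (g : T ≃g T) (hT : T.Connected) {u v w : V} :
    g u ∈ halfTree T (g v) (g w) ↔ u ∈ halfTree T v w := by
  simp only [mem_halfTree, dist_apply g hT]

/-- The only edge leaving a half-tree is its defining edge. -/
theorem eq_of_adj_of_mem_halfTree (hT : T.IsTree) {v w u u' : V} (h : T.Adj v w)
    (ha : T.Adj u u') (hu : u ∈ halfTree T v w) (hu' : u' ∉ halfTree T v w) :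
    u = w ∧ u' = v := by
  have hw := dist_adj_cases hT u h
  have hw' := dist_adj_cases hT u' h
  have h1 := dist_adj_cases hT w ha
  have h2 := dist_adj_cases hT v ha
  simp only [mem_halfTree] at hu hu'
  rw [T.dist_comm (u := u), T.dist_comm (u := u')] at h1 h2
  -- If `u ≠ w`, the next vertex `x` towards `w` is nearer to `v` than `u` is, and so is `u'`. Hence
  -- `x = u'`, but `u'` is farther from `w`.
  have huw : u = w := by
    by_contra hne
    obtain ⟨x, hx, hd⟩ := exists_adj_dist_lt hT hne
    have h3 := dist_adj_cases hT x h
    have h4 := dist_adj_cases hT v hx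
    have hxu : x = u' := by
      refine eq_of_dist_lt hT (u := v) hx ha ?_ ?_
      · rw [T.dist_comm (u := x), T.dist_comm (u := u)]
        rw [T.dist_comm (u := u), T.dist_comm (u := x)] at h4 hd
        omega
      · rw [T.dist_comm (u := u'), T.dist_comm (u := u)]
        omega
    subst hxu
    rw [T.dist_comm (u := u), T.dist_comm (u := x)] at hd
    omega
  refine ⟨huw, ?_⟩
  subst huw
  have h0 : T.dist u u = 0 := SimpleGraph.dist_self
  have h5 : T.dist v u' = 0 := by omega
  exact ((hT.connected.dist_eq_zero_iff).1 h5).symm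

theorem disjoint_halfTree (hT : T.IsTree) {w x y : V} (hx : T.Adj w x) (hy : T.Adj w y)
    (hxy : x ≠ y) : Disjoint (halfTree T w x) (halfTree T w y) :=
  Set.disjoint_left.2 fun _ h1 h2 => hxy (eq_of_dist_lt hT hx hy h1 h2)

theorem halfTree_subset (hT : T.IsTree) {v w x : V} (hv : T.Adj v w) (hx : T.Adj w x)
    (hxv : x ≠ v) : halfTree T w x ⊆ halfTree T v w := by
  intro u hu
  by_contra h
  rw [notMem_halfTree_iff hT hv] at h
  exact hxv (eq_of_dist_lt hT hx hv.symm hu h)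

/-- A geodesic leaving the half-tree must use its defining edge, hence passes through `v`. -/
theorem dist_eq_add_of_halfTree (hT : T.IsTree) {v x v' u : V} (h : T.Adj v x)
    (hu : u ∈ halfTree T v x) (hv' : v' ∉ halfTree T v x) :
    T.dist v' u = T.dist v' v + T.dist v u := by
  classical
  obtain ⟨p, hp⟩ := hT.connected.exists_walk_length_eq_dist u v'
  obtain ⟨e, he, h1, h2⟩ := p.exists_boundary_dart _ hu hv'
  obtain ⟨-, hv⟩ := eq_of_adj_of_mem_halfTree hT h e.adj h1 h2
  have hmem : v ∈ p.support := hv ▸ p.dart_snd_mem_support_of_mem_darts he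
  have hlen := congrArg SimpleGraph.Walk.length (p.take_spec hmem)
  rw [SimpleGraph.Walk.length_append] at hlen
  have h3 := SimpleGraph.dist_le (p.takeUntil v hmem)
  have h4 := SimpleGraph.dist_le (p.dropUntil v hmem)
  have h5 := hT.connected.dist_triangle (u := v') (v := v) (w := u)
  rw [T.dist_comm (u := v') (v := u), T.dist_comm (u := v') (v := v),
    T.dist_comm (u := v) (v := u)] at *
  omega

/-- A common vertex `u` would be farther from `v'` than from `v`, and conversely, each time by the
distance from `v` to `v'`. -/
theorem disjoint_halfTree_of_notMem (hT : T.IsTree) {v x v' x' : V} (h : T.Adj v x)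
    (h' : T.Adj v' x') (hne : v ≠ v') (h1 : v' ∉ halfTree T v x) (h2 : v ∉ halfTree T v' x') :
    Disjoint (halfTree T v x) (halfTree T v' x') := by
  refine Set.disjoint_left.2 fun u hu hu' => hne ?_
  have e1 := dist_eq_add_of_halfTree hT h hu h1
  have e2 := dist_eq_add_of_halfTree hT h' hu' h2
  exact (hT.connected.dist_eq_zero_iff).1 (by omega)

end Tree

end BurgerMozes

namespace BurgerMozes

universe u

/-! ### Automorphisms prescribed by local actions -/

namespace RegularColoring

variable {V : Type u} {T : SimpleGraph V} {d : ℕ} (c : RegularColoring T d)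

/-- The neighbour of `v` along the edge of color `j`. -/
noncomputable def nb (v : V) (j : Fin d) : V := ((c.atVertex v).symm j).1

theorem adj_nb (v : V) (j : Fin d) : T.Adj v (c.nb v j) := ((c.atVertex v).symm j).2

theorem color_nb (v : V) (j : Fin d) : c.color ⟨(v, c.nb v j), c.adj_nb v j⟩ = j :=
  (c.atVertex v).apply_symm_apply j

theorem nb_color {v w : V} (h : T.Adj v w) : c.nb v (c.color ⟨(v, w), h⟩) = w :=
  congrArg Subtype.val ((c.atVertex v).symm_apply_apply ⟨w, h⟩)

theorem exists_nb {v w : V} (h : T.Adj v w) : ∃ j, w = c.nb v j := ⟨_, (c.nb_color h).symm⟩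

theorem nb_injective (v : V) : Function.Injective (c.nb v) := fun _ _ h =>
  (c.atVertex v).symm.injective (Subtype.ext h)

theorem nb_nb (hc : c.IsLegal) (v : V) (j : Fin d) : c.nb (c.nb v j) j = v := by
  have h := hc ⟨(v, c.nb v j), c.adj_nb v j⟩
  rw [c.color_nb] at h
  have h2 := c.nb_color (c.adj_nb v j).symm
  change c.nb (c.nb v j) (c.color (SimpleGraph.Dart.symm ⟨(v, c.nb v j), c.adj_nb v j⟩)) = v at h2
  rwa [h] at h2

theorem apply_nb (g : T ≃g T) (v : V) (j : Fin d) :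
    g (c.nb v j) = c.nb (g v) (c.localAction g v j) := by
  simp [nb, localAction]

theorem localAction_eq {g : T ≃g T} {v : V} {τ : Equiv.Perm (Fin d)}
    (h : ∀ j, g (c.nb v j) = c.nb (g v) (τ j)) : c.localAction g v = τ := by
  ext j
  rw [c.nb_injective (g v) ((c.apply_nb g v j).symm.trans (h j))]

theorem localAction_nb (hc : c.IsLegal) (g : T ≃g T) (v : V) (j : Fin d) :
    c.localAction g (c.nb v j) j = c.localAction g v j := by
  apply c.nb_injective (g (c.nb v j))
  rw [← c.apply_nb, c.nb_nb hc, c.apply_nb, c.nb_nb hc]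

theorem finite_neighborSet (c : RegularColoring T d) (v : V) : (T.neighborSet v).Finite :=
  Set.finite_coe_iff.1 (Finite.of_equiv _ (c.atVertex v).symm)

/-- Step-by-step definition of a map on a tree by following the colors. -/
theorem exists_development (hT : T.IsTree) (hc : c.IsLegal) {X : Type*} (t : V) (x : X)
    (κ : V → Fin d → X → X) (hκ : ∀ v j y, κ (c.nb v j) j (κ v j y) = y) :
    ∃ π : V → X, π t = x ∧ ∀ v j, π (c.nb v j) = κ v j (π v) := by
  classical
  obtain ⟨π, h0, h⟩ := exists_tree_rec hT t x
    (fun v w y => if h : T.Adj v w then κ v (c.color ⟨(v, w), h⟩) y else y)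
  have key : ∀ v j, T.dist (c.nb v j) t = T.dist v t + 1 → π (c.nb v j) = κ v j (π v) := by
    intro v j hd
    have := h _ _ (c.adj_nb v j) hd
    rwa [dif_pos (c.adj_nb v j), c.color_nb] at this
  refine ⟨π, h0, fun v j => ?_⟩
  -- The recursion only gives the steps away from the root. A step towards the root follows since
  -- `hκ` makes the two rules along an edge mutually inverse.
  rcases dist_adj_cases hT t (c.adj_nb v j) with hd | hd
  · have := key (c.nb v j) j (by rwa [c.nb_nb hc])
    rw [c.nb_nb hc] at this
    have h2 := hκ (c.nb v j) j (π (c.nb v j))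
    rw [← this, c.nb_nb hc] at h2
    exact h2.symm
  · exact key v j hd

/-- An automorphism of a legally colored tree may be prescribed by its local actions. -/
theorem exists_iso_localAction (hT : T.IsTree) (hc : c.IsLegal) (ρ : V → Equiv.Perm (Fin d))
    (hρ : ∀ v j, ρ (c.nb v j) j = ρ v j) (t t' : V) :
    ∃ g : T ≃g T, g t = t' ∧ ∀ v, c.localAction g v = ρ v := by
  obtain ⟨f, f0, hf⟩ := c.exists_development hT hc t t' (fun v j y => c.nb y (ρ v j))
    (fun v j y => by rw [hρ, c.nb_nb hc])
  have hρ' : ∀ v j, (ρ (c.nb v ((ρ v).symm j))).symm j = (ρ v).symm j := fun v j => by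
    rw [Equiv.symm_apply_eq, hρ, Equiv.apply_symm_apply]
  -- The inverse map is developed in the same way, from `t'`, reading the permutation at the vertex
  -- reached so far in the source.
  obtain ⟨f', f0', hf'⟩ := c.exists_development hT hc t' t (fun _ j y => c.nb y ((ρ y).symm j))
    (fun v j y => by rw [hρ', c.nb_nb hc])
  have h1 : ∀ v, f' (f v) = v := by
    refine forall_of_adj hT.connected t (by rw [f0, f0']) fun v w h hv => ?_
    obtain ⟨j, rfl⟩ := c.exists_nb h
    rw [hf, hf', hv, Equiv.symm_apply_apply]
  have h2 : ∀ v, f (f' v) = v := by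
    refine forall_of_adj hT.connected t' (by rw [f0', f0]) fun v w h hv => ?_
    obtain ⟨j, rfl⟩ := c.exists_nb h
    rw [hf', hf, hv, Equiv.apply_symm_apply]
  have a1 : ∀ v w, T.Adj v w → T.Adj (f v) (f w) := fun v w h => by
    obtain ⟨j, rfl⟩ := c.exists_nb h
    rw [hf]
    exact c.adj_nb _ _
  have a2 : ∀ v w, T.Adj v w → T.Adj (f' v) (f' w) := fun v w h => by
    obtain ⟨j, rfl⟩ := c.exists_nb h
    rw [hf']
    exact c.adj_nb _ _
  refine ⟨⟨⟨f, f', h1, h2⟩, @fun v w => ⟨fun h => ?_, a1 v w⟩⟩, f0, fun v =>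
    c.localAction_eq (hf v)⟩
  have := a2 _ _ h
  simpa [h1] using this

/-- Automorphisms that agree along edges can be patched together. -/
theorem exists_patch (hT : T.IsTree) (hc : c.IsLegal) (γ : V → (T ≃g T))
    (hγ : ∀ v w, T.Adj v w → γ v w = γ w w) :
    ∃ g : T ≃g T, (∀ v, g v = γ v v) ∧ ∀ v, c.localAction g v = c.localAction (γ v) v := by
  obtain ⟨t⟩ := hT.connected.nonempty
  obtain ⟨g, g0, hg⟩ := c.exists_iso_localAction hT hc (fun v => c.localAction (γ v) v)
    -- `γ v` and its counterpart at the neighbour agree at both ends of the edge, hence send it to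
    -- the same edge, of a single color.
    (fun v j => by
      have h1 := hγ _ _ (c.adj_nb v j)
      have h2 := hγ _ _ (c.adj_nb v j).symm
      rw [c.localAction_nb hc]
      apply c.nb_injective (γ (c.nb v j) v)
      rw [← c.apply_nb, h2, ← c.apply_nb, h1])
    t (γ t t)
  refine ⟨g, forall_of_adj hT.connected t g0 fun v w h hv => ?_, hg⟩
  rw [← hγ v w h]
  obtain ⟨j, rfl⟩ := c.exists_nb h
  rw [c.apply_nb, c.apply_nb, hv, hg]

end RegularColoring

end BurgerMozes

namespace BurgerMozes

universe u

open Filter Topology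

/-! ### The topology of the automorphism group -/

section Topology

variable {V : Type u} {T : SimpleGraph V}

theorem nhds_aut (g : T ≃g T) : 𝓝 g = ⨅ v, 𝓟 {h : T ≃g T | h v = g v} := by
  let _ : TopologicalSpace V := ⊥
  have : DiscreteTopology V := ⟨rfl⟩
  change @nhds _ (TopologicalSpace.induced (fun g : T ≃g T => (g : V → V)) _) g = _
  rw [nhds_induced, nhds_pi, Filter.pi]
  simp only [nhds_discrete, comap_iInf, comap_pure, comap_principal]
  rfl

theorem tendsto_aut {ι : Type*} {l : Filter ι} {φ : ι → (T ≃g T)} {g : T ≃g T} :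
    Tendsto φ l (𝓝 g) ↔ ∀ v, ∀ᶠ i in l, φ i v = g v := by
  rw [nhds_aut]
  simp [tendsto_iInf, tendsto_principal]

theorem eventually_apply_eq (g : T ≃g T) (v : V) : ∀ᶠ h in 𝓝 g, h v = g v :=
  tendsto_aut.1 tendsto_id v

theorem isLocallyConstant_apply (v : V) : IsLocallyConstant fun g : T ≃g T => g v :=
  (IsLocallyConstant.iff_eventually_eq _).2 fun g => eventually_apply_eq g v

/-- A neighbourhood of an automorphism contains all automorphisms that agree with it on some
finite set of vertices. -/
theorem exists_finite_of_mem_nhds {g : T ≃g T} {s : Set (T ≃g T)} (hs : s ∈ 𝓝 g) :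
    ∃ A : Set V, A.Finite ∧ ∀ h : T ≃g T, (∀ v ∈ A, h v = g v) → h ∈ s := by
  rw [nhds_aut, (hasBasis_iInf_principal_finite _).mem_iff] at hs
  obtain ⟨A, hA, h⟩ := hs
  exact ⟨A, hA, fun k hk => h (by simpa using hk)⟩

theorem inv_apply_eq {g : T ≃g T} {v w : V} : g⁻¹ v = w ↔ v = g w :=
  Equiv.symm_apply_eq g.toEquiv

theorem mul_inv_apply (g : T ≃g T) (v : V) : g (g⁻¹ v) = v := g.apply_symm_apply v

theorem inv_mul_apply (g : T ≃g T) (v : V) : g⁻¹ (g v) = v := g.symm_apply_apply v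

instance isTopologicalGroup_aut : IsTopologicalGroup (T ≃g T) where
  continuous_mul := continuous_iff_continuousAt.2 fun ⟨g, h⟩ => tendsto_aut.2 fun v => by
    have h1 : ∀ᶠ x : (T ≃g T) × (T ≃g T) in 𝓝 (g, h), x.1 (h v) = g (h v) :=
      (continuous_fst.tendsto (g, h)).eventually (eventually_apply_eq g (h v))
    have h2 : ∀ᶠ x : (T ≃g T) × (T ≃g T) in 𝓝 (g, h), x.2 v = h v :=
      (continuous_snd.tendsto (g, h)).eventually (eventually_apply_eq h v)
    filter_upwards [h1, h2] with x h1 h2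
    change x.1 (x.2 v) = g (h v)
    rw [h2, h1]
  continuous_inv := continuous_iff_continuousAt.2 fun g => tendsto_aut.2 fun v => by
    filter_upwards [eventually_apply_eq g (g⁻¹ v)] with x hx
    rw [inv_apply_eq, hx, mul_inv_apply]

instance totallySeparatedSpace_aut : TotallySeparatedSpace (T ≃g T) := by
  refine totallySeparatedSpace_iff_exists_isClopen.2 fun g h hne => ?_
  obtain ⟨v, hv⟩ : ∃ v, g v ≠ h v := by
    by_contra! hcon
    exact hne (RelIso.ext hcon)
  exact ⟨{k | k v = g v}, (isLocallyConstant_apply v).isClopen_fiber (g v), rfl,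
    fun h' => hv h'.symm⟩

/-- A filter of automorphisms along which all the images and the inverse images of each vertex are
eventually constant converges. -/
theorem exists_tendsto_aut {ι : Type*} {l : Filter ι} [l.NeBot] {φ : ι → (T ≃g T)}
    (h1 : ∀ v, ∃ w, ∀ᶠ i in l, φ i v = w) (h2 : ∀ v, ∃ w, ∀ᶠ i in l, (φ i)⁻¹ v = w) :
    ∃ g, Tendsto φ l (𝓝 g) := by
  choose f hf using h1
  choose f' hf' using h2
  have i1 : ∀ v, f' (f v) = v := fun v => by
    obtain ⟨i, hi, hi'⟩ := ((hf v).and (hf' (f v))).exists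
    rw [← hi', ← hi, inv_mul_apply]
  have i2 : ∀ v, f (f' v) = v := fun v => by
    obtain ⟨i, hi, hi'⟩ := ((hf' v).and (hf (f' v))).exists
    rw [← hi', ← hi, mul_inv_apply]
  refine ⟨⟨⟨f, f', i1, i2⟩, @fun v w => ?_⟩, tendsto_aut.2 hf⟩
  obtain ⟨i, hi, hi'⟩ := ((hf v).and (hf w)).exists
  change T.Adj (f v) (f w) ↔ T.Adj v w
  rw [← hi, ← hi', SimpleGraph.Iso.map_adj_iff]

theorem finite_setOf_apply (hT : T.Connected) (hfin : ∀ v, (T.neighborSet v).Finite) (a b v : V) :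
    {w | ∃ g : T ≃g T, g a = b ∧ g v = w}.Finite := by
  refine forall_of_adj hT (P := fun v => {w | ∃ g : T ≃g T, g a = b ∧ g v = w}.Finite) a ?_ ?_ v
  · refine (Set.finite_singleton b).subset ?_
    rintro w ⟨g, h1, h2⟩
    exact h2.symm.trans h1
  · intro v v' hv hfv
    refine (hfv.biUnion fun w _ => hfin w).subset ?_
    rintro w ⟨g, h1, rfl⟩
    exact Set.mem_biUnion ⟨g, h1, rfl⟩ (g.map_adj_iff.2 hv)

/-- Local finiteness confines the image of each vertex to a finite set, under the elements and under
their inverses. Along an ultrafilter all these images become constant, so it converges. -/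
theorem isCompact_setOf_apply_eq (hT : T.Connected) (hfin : ∀ v, (T.neighborSet v).Finite)
    (a b : V) : IsCompact {g : T ≃g T | g a = b} := by
  have hclosed : IsClosed {g : T ≃g T | g a = b} :=
    ((isLocallyConstant_apply a).isClopen_fiber b).1
  have key : ∀ (l : Ultrafilter (T ≃g T)) (f : (T ≃g T) → V) (A : Set V), A.Finite →
      (∀ᶠ g in (l : Filter (T ≃g T)), f g ∈ A) →
      ∃ w, ∀ᶠ g in (l : Filter (T ≃g T)), f g = w := by
    intro l f A hA hl
    have : ∀ᶠ g in (l : Filter (T ≃g T)), ∃ w ∈ A, f g = w := by simpa using hl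
    obtain ⟨w, -, hw⟩ := (Ultrafilter.eventually_exists_mem_iff hA).1 this
    exact ⟨w, hw⟩
  refine isCompact_iff_ultrafilter_le_nhds.2 fun l hl => ?_
  rw [le_principal_iff] at hl
  obtain ⟨g, hg⟩ := exists_tendsto_aut (l := (l : Filter (T ≃g T))) (φ := id)
    (fun v => key l _ _ (finite_setOf_apply hT hfin a b v) (mem_of_superset hl fun g hg =>
      ⟨g, hg, rfl⟩))
    (fun v => key l _ _ (finite_setOf_apply hT hfin b a v) (mem_of_superset hl fun g hg =>
      ⟨g⁻¹, inv_apply_eq.2 (Eq.symm hg), rfl⟩))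
  exact ⟨g, hclosed.mem_of_tendsto hg hl, hg⟩

theorem locallyCompactSpace_aut (hT : T.Connected) (hfin : ∀ v, (T.neighborSet v).Finite) :
    LocallyCompactSpace (T ≃g T) := by
  obtain ⟨a⟩ := hT.nonempty
  exact (isCompact_setOf_apply_eq hT hfin a a).locallyCompactSpace_of_mem_nhds_of_group
    (eventually_apply_eq 1 a)

variable {d : ℕ} (c : RegularColoring T d)

theorem isLocallyConstant_localAction (v : V) :
    IsLocallyConstant fun g : T ≃g T => c.localAction g v := by
  refine (IsLocallyConstant.iff_eventually_eq _).2 fun g => ?_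
  have : ∀ᶠ h in 𝓝 g, ∀ j, h (c.nb v j) = g (c.nb v j) :=
    eventually_all.2 fun j => eventually_apply_eq g _
  filter_upwards [eventually_apply_eq g v, this] with h h0 h1
  exact c.localAction_eq fun j => by rw [h1, h0, c.apply_nb]

theorem isClosed_universalGroup (F : Subgroup (Equiv.Perm (Fin d))) :
    IsClosed (universalGroup c F : Set (T ≃g T)) := by
  have : (universalGroup c F : Set (T ≃g T)) = ⋂ v, {g | c.localAction g v ∈ F} := by
    ext g
    simp only [Set.mem_iInter]
    rfl
  rw [this]
  exact isClosed_iInter fun v => isOpen_compl_iff.1 (isLocallyConstant_localAction c v {τ | τ ∉ F})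

theorem plus_le (G : Subgroup (T ≃g T)) : plus G ≤ G :=
  (Subgroup.closure_le _).2 fun _ h => h.1

theorem mem_plus {G : Subgroup (T ≃g T)} {g : T ≃g T} (hg : g ∈ G) {v w : V} (h : T.Adj v w)
    (h1 : g v = v) (h2 : g w = w) : g ∈ plus G :=
  Subgroup.subset_closure ⟨hg, v, w, h, h1, h2⟩

/-- `plus G` contains the fixator of an edge, which is open in `G`; an open subgroup is closed. -/
theorem isClosed_plus {G : Subgroup (T ≃g T)} (hG : IsClosed (G : Set (T ≃g T))) {v w : V}
    (h : T.Adj v w) : IsClosed (plus G : Set (T ≃g T)) := by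
  refine isClosed_of_closure_subset fun g hg => ?_
  have hgG : g ∈ G := hG.closure_subset_iff.2 (plus_le G) hg
  obtain ⟨k, ⟨hk1, hk2⟩, hk⟩ := (mem_closure_iff_nhds.1 hg _
    ((eventually_apply_eq g v).and (eventually_apply_eq g w)))
  have : k⁻¹ * g ∈ plus G := mem_plus (G.mul_mem (G.inv_mem (plus_le G hk)) hgG) h
    (inv_apply_eq.2 hk1.symm) (inv_apply_eq.2 hk2.symm)
  have := (plus G).mul_mem hk this
  rwa [mul_inv_cancel_left] at this

end Topology

end BurgerMozes

namespace BurgerMozes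

universe u

open Filter Topology

/-! ### Simplicity and non-discreteness of U(F)⁺ -/

section Simplicity

variable {V : Type u} {T : SimpleGraph V} {n : ℕ} {c : RegularColoring T n}
  {F : Subgroup (Equiv.Perm (Fin n))}

theorem mul_apply_aut (g h : T ≃g T) (v : V) : (g * h) v = g (h v) := rfl

/-- The conditions on a permutation group that are used for the simplicity of `U(F)⁺`: it has
enough points, the point stabilizers generate a transitive group, and each of them contains an
element with a single fixed point. -/
structure IsAdmissible (F : Subgroup (Equiv.Perm (Fin n))) : Prop where
  three_le : 3 ≤ n
  transitive : ∀ i j, ∃ f ∈ Subgroup.closure {f | f ∈ F ∧ ∃ k, f k = k}, f i = j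
  single : ∀ k, ∃ f ∈ F, f k = k ∧ ∀ i, i ≠ k → f i ≠ i

/-- A constant family of local actions is always compatible along edges; the edge of color `k` at
`v` is fixed. -/
theorem exists_fixing_of_mem (hT : T.IsTree) (hc : c.IsLegal) {f : Equiv.Perm (Fin n)}
    (hf : f ∈ F) {k : Fin n} (hk : f k = k) (v : V) :
    ∃ g ∈ plus (universalGroup c F), g v = v ∧ c.localAction g v = f := by
  obtain ⟨g, h0, h⟩ := c.exists_iso_localAction hT hc (fun _ => f) (fun _ _ => rfl) v v
  refine ⟨g, mem_plus (fun u => ?_) (c.adj_nb v k) h0 ?_, h0, h v⟩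
  · rw [h]
    exact hf
  · rw [c.apply_nb, h0, h, hk]

theorem exists_rotation (hT : T.IsTree) (hc : c.IsLegal) (hF : IsAdmissible F) (v : V) {w w' : V}
    (hw : T.Adj v w) (hw' : T.Adj v w') :
    ∃ g ∈ plus (universalGroup c F), g v = v ∧ g w = w' := by
  obtain ⟨i, rfl⟩ := c.exists_nb hw
  obtain ⟨j, rfl⟩ := c.exists_nb hw'
  obtain ⟨f, hf, rfl⟩ := hF.transitive i j
  clear hw'
  suffices h : ∃ g ∈ plus (universalGroup c F), g v = v ∧ c.localAction g v = f by
    obtain ⟨g, hg, h0, h⟩ := h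
    exact ⟨g, hg, h0, by rw [c.apply_nb, h0, h]⟩
  induction hf using Subgroup.closure_induction with
  | mem f hf =>
    obtain ⟨hf, k, hk⟩ := hf
    exact exists_fixing_of_mem hT hc hf hk v
  | one => exact ⟨1, one_mem _, rfl, c.localAction_one v⟩
  | mul f f' _ _ h h' =>
    obtain ⟨g, hg, h0, h⟩ := h
    obtain ⟨g', hg', h0', h'⟩ := h'
    refine ⟨g * g', mul_mem hg hg', by rw [mul_apply_aut, h0', h0], ?_⟩
    rw [c.localAction_mul, h0', h, h']
  | inv f _ h =>
    obtain ⟨g, hg, h0, h⟩ := h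
    have h0' : g⁻¹ v = v := inv_apply_eq.2 h0.symm
    refine ⟨g⁻¹, inv_mem hg, h0', ?_⟩
    have := c.localAction_mul g g⁻¹ v
    rw [mul_inv_cancel, c.localAction_one, h0', h] at this
    exact eq_inv_of_mul_eq_one_right this.symm

/-- `U(F)⁺` has at most two orbits on directed edges. -/
theorem exists_move_dart (hT : T.IsTree) (hc : c.IsLegal) (hF : IsAdmissible F) {a b : V}
    (hab : T.Adj a b) {v w : V} (hvw : T.Adj v w) :
    ∃ g ∈ plus (universalGroup c F), (g v = a ∧ g w = b) ∨ (g v = b ∧ g w = a) := by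
  refine forall_of_adj hT.connected (P := fun v => ∀ w, T.Adj v w →
    ∃ g ∈ plus (universalGroup c F), (g v = a ∧ g w = b) ∨ (g v = b ∧ g w = a)) a ?_ ?_ v w hvw
  · intro w hw
    obtain ⟨g, hg, h⟩ := exists_rotation hT hc hF a hw hab
    exact ⟨g, hg, Or.inl h⟩
  -- A directed edge at `v'` rotates onto the reverse of the one from `v` to `v'`; the orientation
  -- flips at each step, whence the two cases.
  · intro v v' hv hP w hw
    obtain ⟨g, hg, h1, h2⟩ := exists_rotation hT hc hF v' hw hv.symm
    obtain ⟨g', hg', h'⟩ := hP v' hv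
    refine ⟨g' * g, mul_mem hg' hg, ?_⟩
    simp only [mul_apply_aut, h1, h2]
    tauto

/-- Pigeonhole: two properties, each of at most one element, cannot cover three. -/
theorem exists_not_and_not {n : ℕ} (hn : 3 ≤ n) {P Q : Fin n → Prop}
    (hP : ∀ i j, P i → P j → i = j) (hQ : ∀ i j, Q i → Q j → i = j) : ∃ i, ¬ P i ∧ ¬ Q i := by
  by_contra! h
  have h0 : ∀ i, P i ∨ Q i := fun i => or_iff_not_imp_left.2 (h i)
  have n1 : (⟨0, by omega⟩ : Fin n) ≠ ⟨1, by omega⟩ := by simp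
  have n2 : (⟨0, by omega⟩ : Fin n) ≠ ⟨2, by omega⟩ := by simp
  have n3 : (⟨1, by omega⟩ : Fin n) ≠ ⟨2, by omega⟩ := by simp
  rcases h0 ⟨0, by omega⟩ with h1 | h1 <;> rcases h0 ⟨1, by omega⟩ with h2 | h2 <;>
    rcases h0 ⟨2, by omega⟩ with h3 | h3 <;>
    first
    | exact n1 (hP _ _ h1 h2)
    | exact n1 (hQ _ _ h1 h2)
    | exact n2 (hP _ _ h1 h3)
    | exact n2 (hQ _ _ h1 h3)
    | exact n3 (hP _ _ h2 h3)
    | exact n3 (hQ _ _ h2 h3)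

/-- A nontrivial subgroup normalized by `U(F)⁺` contains an element whose powers translate some
half-tree off itself. -/
theorem exists_translation (hT : T.IsTree) (hc : c.IsLegal) (hF : IsAdmissible F)
    {N : Subgroup (T ≃g T)} (hN : ∀ g ∈ plus (universalGroup c F), ∀ m ∈ N, g * m * g⁻¹ ∈ N)
    {m₀ : T ≃g T} (hm₀ : m₀ ∈ N) (hne : m₀ ≠ 1) :
    ∃ m ∈ N, ∃ w y, T.Adj w y ∧
      ∀ k : ℤ, ∀ u ∈ halfTree T w y, (m ^ k) u ∈ halfTree T w y → k = 0 := by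
  obtain ⟨v, hv⟩ : ∃ v, m₀ v ≠ v := by
    by_contra! h
    exact hne (RelIso.ext h)
  -- Each condition excludes at most one color. With such an `i`, the half-tree A beyond the edge of
  -- color `i` at `v` is disjoint from its image under `m₀`.
  obtain ⟨i, hi1, hi2⟩ := exists_not_and_not hF.three_le
    (P := fun i => m₀ v ∈ halfTree T v (c.nb v i))
    (Q := fun i => v ∈ halfTree T (m₀ v) (m₀ (c.nb v i)))
    (fun i j hi hj => c.nb_injective v
      (eq_of_dist_lt hT (c.adj_nb v i) (c.adj_nb v j) hi hj))
    (fun i j hi hj => c.nb_injective v (m₀.injective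
      (eq_of_dist_lt hT (m₀.map_adj_iff.2 (c.adj_nb v i)) (m₀.map_adj_iff.2 (c.adj_nb v j)) hi hj)))
  set w := c.nb v i with hw
  have hvw : T.Adj v w := c.adj_nb v i
  have hvi : v = c.nb w i := (c.nb_nb hc v i).symm
  have hdisj := disjoint_halfTree_of_notMem hT hvw (m₀.map_adj_iff.2 hvw) hv.symm hi1 hi2
  have hmA : ∀ u ∈ halfTree T v w, m₀ u ∈ halfTree T w v := fun u hu => by
    rw [← notMem_halfTree_iff hT hvw]
    exact fun h => Set.disjoint_left.1 hdisj h ((apply_mem_halfTree m₀ hT.connected).2 hu)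
  obtain ⟨k, hk, -⟩ := exists_not_and_not hF.three_le (P := (· = i)) (Q := (· = i))
    (by rintro i j rfl rfl; rfl) (by rintro i j rfl rfl; rfl)
  obtain ⟨f, hf, hfk, hfi⟩ := hF.single k
  obtain ⟨g, hg, hgw, hgf⟩ := exists_fixing_of_mem hT hc hf hfk w
  have hgv : g v = c.nb w (f i) := by
    conv_lhs => rw [hvi]
    rw [c.apply_nb, hgw, hgf]
  have hgv' : g v ≠ v := by
    rw [hgv]
    conv_rhs => rw [hvi]
    exact fun h => hfi i (Ne.symm hk) (c.nb_injective w h)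
  have hgw' : g⁻¹ w = w := inv_apply_eq.2 hgw.symm
  have hgv'' : g⁻¹ v ≠ v := fun h => hgv' (inv_apply_eq.1 h).symm
  have hwx : T.Adj w (g v) := by
    conv_lhs => rw [← hgw]
    exact g.map_adj_iff.2 hvw.symm
  have hwx' : T.Adj w (g⁻¹ v) := by
    conv_lhs => rw [← hgw']
    exact g⁻¹.map_adj_iff.2 hvw.symm
  -- `m₀` sends A into the branch at `w` through `v`, and `g⁻¹` rotates that branch back into A.
  -- Repeating this with `m₀` and `g` shows that `m` sends A into the branch at `w` through `g v`, a
  -- part of A. The branch of color `k` also lies in A but is disjoint from that one.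
  let m := g * m₀ * g⁻¹ * m₀
  have hm : m ∈ N := mul_mem (hN g hg _ hm₀) hm₀
  have hmx : ∀ u ∈ halfTree T v w, m u ∈ halfTree T w (g v) := fun u hu => by
    have h1 := (apply_mem_halfTree g⁻¹ hT.connected).2 (hmA u hu)
    rw [hgw'] at h1
    have h2 := hmA _ (halfTree_subset hT hvw hwx' hgv'' h1)
    have h3 := (apply_mem_halfTree g hT.connected).2 h2
    rwa [hgw] at h3
  have hxA : halfTree T w (g v) ⊆ halfTree T v w := halfTree_subset hT hvw hwx hgv'
  have hyA : halfTree T w (c.nb w k) ⊆ halfTree T v w := by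
    refine halfTree_subset hT hvw (c.adj_nb w k) fun h => hk ?_
    rw [hvi] at h
    exact c.nb_injective _ h
  have hxy : g v ≠ c.nb w k := by
    rw [hgv]
    intro h
    have := c.nb_injective _ h
    exact hk (f.injective (hfk.trans this.symm))
  have hd := disjoint_halfTree hT hwx (c.adj_nb w k) hxy
  have hpow : ∀ (j : ℕ), ∀ u ∈ halfTree T v w, (m ^ (j + 1)) u ∈ halfTree T w (g v) := by
    intro j
    induction j with
    | zero => simpa using hmx
    | succ j ih =>
      intro u hu
      rw [pow_succ']
      exact hmx _ (hxA (ih u hu))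
  have hpos : ∀ (j : ℕ), ∀ u ∈ halfTree T w (c.nb w k),
      (m ^ (j + 1)) u ∉ halfTree T w (c.nb w k) :=
    fun j u hu => Set.disjoint_left.1 hd (hpow j u (hyA hu))
  refine ⟨m, hm, w, c.nb w k, c.adj_nb w k, fun z u hu hzu => ?_⟩
  by_contra hz
  rcases lt_or_gt_of_ne hz with hz | hz
  · obtain ⟨j, rfl⟩ : ∃ j : ℕ, z = -((j + 1 : ℕ) : ℤ) := ⟨(-z).toNat - 1, by omega⟩
    refine hpos j _ hzu ?_
    rw [zpow_neg, zpow_natCast, mul_inv_apply]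
    exact hu
  · obtain ⟨j, rfl⟩ : ∃ j : ℕ, z = ((j + 1 : ℕ) : ℤ) := ⟨z.toNat - 1, by omega⟩
    rw [zpow_natCast] at hzu
    exact hpos j u hu hzu

/-- An automorphism in `U(F)` fixing an edge may be replaced by the identity on one side of it. -/
theorem exists_restrict_halfTree (hT : T.IsTree) (hc : c.IsLegal) {g : T ≃g T}
    (hg : g ∈ universalGroup c F) {p q : V} (hpq : T.Adj p q) (hp : g p = p) (hq : g q = q) :
    ∃ k ∈ universalGroup c F, (∀ u ∈ halfTree T p q, k u = g u) ∧
      ∀ u ∉ halfTree T p q, k u = u := by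
  classical
  obtain ⟨k, hk, hk'⟩ := c.exists_patch hT hc
    (fun u => if u ∈ halfTree T p q then g else 1) (fun v w h => by
      by_cases h1 : v ∈ halfTree T p q <;> by_cases h2 : w ∈ halfTree T p q
      · simp [h1, h2]
      · obtain ⟨rfl, rfl⟩ := eq_of_adj_of_mem_halfTree hT hpq h h1 h2
        simpa [h1, h2] using hp
      · obtain ⟨rfl, rfl⟩ := eq_of_adj_of_mem_halfTree hT hpq h.symm h2 h1
        simpa [h1, h2] using hq.symm
      · simp [h1, h2])
  refine ⟨k, fun u => ?_, fun u hu => by rw [hk, if_pos hu], fun u hu => by rw [hk, if_neg hu]; rfl⟩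
  rw [hk']
  split_ifs
  · exact hg u
  · rw [c.localAction_one]
    exact one_mem F

/-- The half-tree is preserved and `w` is fixed, while `y` is the only neighbour of `w` in the
half-tree. -/
theorem apply_target_eq (hT : T.IsTree) {w y : V} (hwy : T.Adj w y) {h : T ≃g T}
    (hs : ∀ u ∉ halfTree T w y, h u = u) : h y = y := by
  have hw : h w = w := hs w (source_notMem_halfTree w y)
  have hy : h y ∈ halfTree T w y := by
    by_contra hcon
    have h1 := hs _ hcon
    rw [h.injective h1] at hcon
    exact hcon (target_mem_halfTree hwy)
  have hadj : T.Adj (h y) w := by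
    conv_rhs => rw [← hw]
    exact h.map_adj_iff.2 hwy.symm
  exact (eq_of_adj_of_mem_halfTree hT hwy hadj hy (source_notMem_halfTree w y)).1

/-- If the powers of `m` translate a half-tree off itself, then every element of `U(F)` supported
on that half-tree is a commutator of `m` with an infinite product of its translates. -/
theorem exists_commutator (hT : T.IsTree) (hc : c.IsLegal) {m h : T ≃g T}
    (hm : m ∈ universalGroup c F) (hh : h ∈ universalGroup c F) {w y : V} (hwy : T.Adj w y)
    (hB : ∀ k : ℤ, ∀ u ∈ halfTree T w y, (m ^ k) u ∈ halfTree T w y → k = 0)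
    (hs : ∀ u ∉ halfTree T w y, h u = u) :
    ∃ k ∈ plus (universalGroup c F), h = k * m * k⁻¹ * m⁻¹ := by
  classical
  set B := halfTree T w y with hBdef
  have huniq : ∀ u (i j : ℕ), (m ^ i)⁻¹ u ∈ B → (m ^ j)⁻¹ u ∈ B → i = j := by
    intro u i j hi hj
    have e : (m ^ ((i : ℤ) - j)) ((m ^ i)⁻¹ u) = (m ^ j)⁻¹ u := by
      rw [← mul_apply_aut]
      congr 1
      rw [← zpow_natCast, ← zpow_natCast, ← zpow_neg, ← zpow_neg, ← zpow_add]
      congr 1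
      ring
    have := hB _ _ hi (e ▸ hj)
    omega
  -- The translates of B under the powers `m ^ i` are disjoint, so the product of all `τ i` makes
  -- sense: it acts as `τ i` on the translate of B by `m ^ i` and trivially elsewhere.
  let τ : ℕ → (T ≃g T) := fun i => m ^ i * h * (m ^ i)⁻¹
  have hτ : ∀ i u, τ i u = (m ^ i) (h ((m ^ i)⁻¹ u)) := fun _ _ => rfl
  have hτU : ∀ i, τ i ∈ universalGroup c F := fun i =>
    mul_mem (mul_mem (pow_mem hm i) hh) (inv_mem (pow_mem hm i))
  have hτ_out : ∀ i u, (m ^ i)⁻¹ u ∉ B → τ i u = u := fun i u hu => by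
    rw [hτ, hs _ hu, mul_inv_apply]
  have hτ_cross : ∀ i u u', T.Adj u u' → (m ^ i)⁻¹ u ∈ B → (m ^ i)⁻¹ u' ∉ B → τ i u = u := by
    intro i u u' ha h1 h2
    have := (eq_of_adj_of_mem_halfTree hT hwy ((m ^ i)⁻¹.map_adj_iff.2 ha) h1 h2).1
    rw [hτ, this, apply_target_eq hT hwy hs, ← this, mul_inv_apply]
  let γ : V → (T ≃g T) := fun u => if hu : ∃ i : ℕ, (m ^ i)⁻¹ u ∈ B then τ hu.choose else 1
  have hγ_in : ∀ u i, (m ^ i)⁻¹ u ∈ B → γ u = τ i := by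
    intro u i hi
    have hex : ∃ i : ℕ, (m ^ i)⁻¹ u ∈ B := ⟨i, hi⟩
    simp only [γ, dif_pos hex]
    rw [huniq u _ i hex.choose_spec hi]
  have hγ_out : ∀ u, (∀ i : ℕ, (m ^ i)⁻¹ u ∉ B) → γ u = 1 := fun u hu => by
    simp only [γ]
    rw [dif_neg (by simpa using hu)]
  have hγ_fix : ∀ u u', T.Adj u u' → (¬ ∃ i : ℕ, (m ^ i)⁻¹ u ∈ B ∧ (m ^ i)⁻¹ u' ∈ B) →
      γ u u' = u' ∧ γ u' u' = u' := by
    intro u u' ha hno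
    constructor
    · by_cases hu : ∃ i : ℕ, (m ^ i)⁻¹ u ∈ B
      · obtain ⟨i, hi⟩ := hu
        rw [hγ_in u i hi]
        exact hτ_out i u' fun h' => hno ⟨i, hi, h'⟩
      · rw [hγ_out u (by simpa using hu)]
        rfl
    · by_cases hu : ∃ i : ℕ, (m ^ i)⁻¹ u' ∈ B
      · obtain ⟨i, hi⟩ := hu
        rw [hγ_in u' i hi]
        exact hτ_cross i u' u ha.symm hi fun h' => hno ⟨i, h', hi⟩
      · rw [hγ_out u' (by simpa using hu)]
        rfl
  obtain ⟨k, hk, hk'⟩ := c.exists_patch hT hc γ (fun u u' ha => by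
    by_cases hsame : ∃ i : ℕ, (m ^ i)⁻¹ u ∈ B ∧ (m ^ i)⁻¹ u' ∈ B
    · obtain ⟨i, h1, h2⟩ := hsame
      rw [hγ_in u i h1, hγ_in u' i h2]
    · obtain ⟨h1, h2⟩ := hγ_fix u u' ha hsame
      rw [h1, h2])
  have hkU : k ∈ universalGroup c F := fun u => by
    rw [hk']
    by_cases hu : ∃ i : ℕ, (m ^ i)⁻¹ u ∈ B
    · obtain ⟨i, hi⟩ := hu
      rw [hγ_in u i hi]
      exact hτU i u
    · rw [hγ_out u (by simpa using hu), c.localAction_one]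
      exact one_mem F
  have hno : ¬ ∃ i : ℕ, (m ^ i)⁻¹ y ∈ B ∧ (m ^ i)⁻¹ w ∈ B := by
    rintro ⟨i, h1, h2⟩
    have := huniq y i 0 h1 (by simpa using target_mem_halfTree hwy)
    subst this
    exact source_notMem_halfTree w y (by simpa using h2)
  have hno' : ¬ ∃ i : ℕ, (m ^ i)⁻¹ w ∈ B ∧ (m ^ i)⁻¹ y ∈ B := fun ⟨i, h1, h2⟩ => hno ⟨i, h2, h1⟩
  refine ⟨k, mem_plus hkU hwy ?_ ?_, ?_⟩
  · rw [hk]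
    exact (hγ_fix y w hwy.symm hno).2
  · rw [hk]
    exact (hγ_fix w y hwy hno').2
  -- Conjugation by `m` shifts the product by one, so only the factor `τ 0 = h` is missing.
  have key : k = h * (m * k * m⁻¹) := by
    refine RelIso.ext fun u => ?_
    change k u = h (m (k (m⁻¹ u)))
    have hshift : ∀ i : ℕ, (m ^ i)⁻¹ (m⁻¹ u) = (m ^ (i + 1))⁻¹ u := fun i => by
      rw [pow_succ', mul_inv_rev]
      rfl
    by_cases hu : ∃ i : ℕ, (m ^ (i + 1))⁻¹ u ∈ B
    · obtain ⟨i, hi⟩ := hu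
      have hu' : u ∉ B := fun h' => by
        have := huniq u (i + 1) 0 hi (by simpa using h')
        omega
      rw [hk, hk, hγ_in u (i + 1) hi, hγ_in (m⁻¹ u) i (by rwa [hshift])]
      have e : m (τ i (m⁻¹ u)) = τ (i + 1) u := by
        rw [hτ, hτ, hshift]
        rw [pow_succ' m i]
        rfl
      rw [e]
      refine (hs _ fun h' => ?_).symm
      by_cases hin : h ((m ^ (i + 1))⁻¹ u) ∈ B
      · have := huniq (τ (i + 1) u) (i + 1) 0 (by rwa [hτ, inv_mul_apply]) (by simpa using h')
        omega
      · rw [h.injective (hs _ hin)] at hin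
        exact hin hi
    · have hu' : ∀ i : ℕ, (m ^ (i + 1))⁻¹ u ∉ B := by simpa using hu
      rw [hk (m⁻¹ u), hγ_out (m⁻¹ u) (fun i => by rw [hshift]; exact hu' i)]
      change k u = h (m (m⁻¹ u))
      rw [mul_inv_apply, hk]
      by_cases h0 : u ∈ B
      · rw [hγ_in u 0 (by simpa using h0), hτ]
        simp
      · rw [hs u h0, hγ_out u]
        · rfl
        · rintro (_ | i)
          · simpa using h0
          · exact hu' i
  calc h = (h * (m * k * m⁻¹)) * (m * k⁻¹ * m⁻¹) := by group
    _ = k * (m * k⁻¹ * m⁻¹) := by rw [← key]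
    _ = k * m * k⁻¹ * m⁻¹ := by group

/-- A nontrivial subgroup of `U(F)⁺` normalized by `U(F)⁺` is all of it. -/
theorem plus_le_of_normalized (hT : T.IsTree) (hc : c.IsLegal) (hF : IsAdmissible F)
    {N : Subgroup (T ≃g T)} (hNle : N ≤ plus (universalGroup c F))
    (hN : ∀ g ∈ plus (universalGroup c F), ∀ m ∈ N, g * m * g⁻¹ ∈ N)
    {m₀ : T ≃g T} (hm₀ : m₀ ∈ N) (hne : m₀ ≠ 1) : plus (universalGroup c F) ≤ N := by
  obtain ⟨m, hm, w, y, hwy, hB⟩ := exists_translation hT hc hF hN hm₀ hne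
  have hsupp : ∀ h ∈ universalGroup c F, (∀ u ∉ halfTree T w y, h u = u) → h ∈ N := by
    intro h hh hs
    obtain ⟨k, hk, rfl⟩ := exists_commutator hT hc (plus_le _ (hNle hm)) hh hwy hB hs
    exact mul_mem (hN k hk m hm) (inv_mem hm)
  obtain ⟨j, hj⟩ := c.exists_nb hwy.symm
  obtain ⟨i, hi, -⟩ := exists_not_and_not hF.three_le (P := (· = j)) (Q := (· = j))
    (by rintro i j rfl rfl; rfl) (by rintro i j rfl rfl; rfl)
  have hyi : c.nb y i ≠ w := fun h => hi (c.nb_injective y (h.trans hj))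
  have hsub := halfTree_subset hT hwy (c.adj_nb y i) hyi
  have hconj : ∀ p q, T.Adj p q → ∃ g ∈ plus (universalGroup c F),
      halfTree T (g p) (g q) ⊆ halfTree T w y := by
    intro p q hpq
    obtain ⟨g, hg, ⟨h1, h2⟩ | ⟨h1, h2⟩⟩ := exists_move_dart hT hc hF hwy hpq
    · exact ⟨g, hg, by rw [h1, h2]⟩
    -- The half-tree has landed on the complement of the target; a rotation about `y` moves it to a
    -- branch inside the target.
    · obtain ⟨g', hg', h1', h2'⟩ := exists_rotation hT hc hF y hwy.symm (c.adj_nb y i)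
      refine ⟨g' * g, mul_mem hg' hg, ?_⟩
      rw [mul_apply_aut, mul_apply_aut, h1, h2, h1', h2']
      exact hsub
  have hall : ∀ p q, T.Adj p q → ∀ h ∈ universalGroup c F,
      (∀ u ∉ halfTree T p q, h u = u) → h ∈ N := by
    intro p q hpq h hh hs
    obtain ⟨g, hg, hgs⟩ := hconj p q hpq
    have hgU := plus_le _ hg
    have := hsupp (g * h * g⁻¹) (mul_mem (mul_mem hgU hh) (inv_mem hgU)) fun u hu => by
      change g (h (g⁻¹ u)) = u
      rw [hs, mul_inv_apply]
      intro h'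
      have h2 := hgs ((apply_mem_halfTree g hT.connected).2 h')
      rw [mul_inv_apply] at h2
      exact hu h2
    have := hN g⁻¹ (inv_mem hg) _ this
    simpa [mul_assoc] using this
  refine (Subgroup.closure_le _).2 ?_
  rintro g ⟨hg, p, q, hpq, hp, hq⟩
  -- Independence: an element fixing an edge is the product of an element supported on one side and
  -- one supported on the other.
  obtain ⟨k, hk, hk1, hk2⟩ := exists_restrict_halfTree hT hc hg hpq hp hq
  have h1 := hall p q hpq k hk hk2
  have h2 := hall q p hpq.symm (k⁻¹ * g) (mul_mem (inv_mem hk) hg) fun u hu => by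
    change k⁻¹ (g u) = u
    rw [notMem_halfTree_iff hT hpq.symm] at hu
    rw [inv_apply_eq, hk1 u hu]
  have := mul_mem h1 h2
  rwa [mul_inv_cancel_left] at this

/-- Each half-tree carries a nontrivial element of `U(F)⁺`. -/
theorem exists_supported (hT : T.IsTree) (hc : c.IsLegal) (hF : IsAdmissible F) {w y : V}
    (hwy : T.Adj w y) :
    ∃ h ∈ plus (universalGroup c F), h ≠ 1 ∧ ∀ u ∉ halfTree T w y, h u = u := by
  obtain ⟨j, hj⟩ := c.exists_nb hwy.symm
  obtain ⟨f, hf, hfj, hfi⟩ := hF.single j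
  obtain ⟨g, hg, hgy, hgf⟩ := exists_fixing_of_mem hT hc hf hfj y
  have hgw : g w = w := by
    conv_lhs => rw [hj]
    rw [c.apply_nb, hgy, hgf, hfj, ← hj]
  obtain ⟨k, hk, hk1, hk2⟩ := exists_restrict_halfTree hT hc (plus_le _ hg) hwy hgw hgy
  obtain ⟨i, hi, -⟩ := exists_not_and_not hF.three_le (P := (· = j)) (Q := (· = j))
    (by rintro i j rfl rfl; rfl) (by rintro i j rfl rfl; rfl)
  have hyi : c.nb y i ≠ w := fun h => hi (c.nb_injective y (h.trans hj))
  have hin := halfTree_subset hT hwy (c.adj_nb y i) hyi (target_mem_halfTree (c.adj_nb y i))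
  refine ⟨k, mem_plus hk hwy (hk2 w (source_notMem_halfTree w y))
    (apply_target_eq hT hwy hk2), ?_, hk2⟩
  rintro rfl
  have h1 := hk1 _ hin
  rw [c.apply_nb g, hgy, hgf] at h1
  exact hfi i hi (c.nb_injective y h1).symm

theorem isSimpleGroup_plus (hT : T.IsTree) (hc : c.IsLegal) (hF : IsAdmissible F) :
    IsSimpleGroup (plus (universalGroup c F)) := by
  obtain ⟨v⟩ := hT.connected.nonempty
  have hadj := c.adj_nb v ⟨0, by have := hF.three_le; omega⟩
  obtain ⟨h, hh, hne, -⟩ := exists_supported hT hc hF hadj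
  have : Nontrivial (plus (universalGroup c F)) :=
    ⟨⟨h, hh⟩, 1, fun h' => hne (congrArg Subtype.val h')⟩
  refine ⟨fun N hN => or_iff_not_imp_left.2 fun hbot => ?_⟩
  obtain ⟨m₀, hm₀, hm₀1⟩ := (Subgroup.bot_or_exists_ne_one N).resolve_left hbot
  have hle := plus_le_of_normalized hT hc hF (N := N.map (plus (universalGroup c F)).subtype)
    (Subgroup.map_subtype_le N)
    (by
      rintro g hg _ ⟨m, hm, rfl⟩
      exact ⟨⟨g, hg⟩ * m * ⟨g, hg⟩⁻¹, hN.conj_mem m hm ⟨g, hg⟩, rfl⟩)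
    (Subgroup.mem_map_of_mem _ hm₀) (fun h1 => hm₀1 (Subtype.ext h1))
  refine eq_top_iff.2 fun g _ => ?_
  obtain ⟨g', hg', he⟩ := hle g.2
  exact Subtype.ext he ▸ hg'

/-- Conjugates of an element supported on a half-tree, by powers of a translation, have disjoint
supports. Some of them avoid any given finite set of vertices, so nontrivial elements accumulate at
1. -/
theorem not_discreteTopology_plus (hT : T.IsTree) (hc : c.IsLegal) (hF : IsAdmissible F) :
    ¬ DiscreteTopology (plus (universalGroup c F)) := by
  intro hdisc
  obtain ⟨v⟩ := hT.connected.nonempty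
  have hadj := c.adj_nb v ⟨0, by have := hF.three_le; omega⟩
  obtain ⟨m₀, hm₀, hne, -⟩ := exists_supported hT hc hF hadj
  obtain ⟨m, hm, w, y, hwy, hB⟩ := exists_translation hT hc hF
    (N := plus (universalGroup c F)) (fun g hg m hm => mul_mem (mul_mem hg hm) (inv_mem hg))
    hm₀ hne
  obtain ⟨h, hh, hh1, hs⟩ := exists_supported hT hc hF hwy
  have hone : ({1} : Set (plus (universalGroup c F))) ∈ 𝓝 1 :=
    (isOpen_discrete _).mem_nhds rfl
  rw [mem_nhds_subtype] at hone
  obtain ⟨s, hs1, hs2⟩ := hone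
  obtain ⟨A, hA, hAs⟩ := exists_finite_of_mem_nhds hs1
  obtain ⟨i, hi⟩ : ∃ i : ℕ, ∀ u ∈ A, (m ^ i)⁻¹ u ∉ halfTree T w y := by
    by_contra! hcon
    choose f hfA hf using hcon
    have hinj : Function.Injective f := by
      intro i j hij
      have e : (m ^ ((i : ℤ) - j)) ((m ^ i)⁻¹ (f i)) = (m ^ j)⁻¹ (f j) := by
        rw [← mul_apply_aut, hij]
        congr 1
        rw [← zpow_natCast, ← zpow_natCast, ← zpow_neg, ← zpow_neg, ← zpow_add]
        congr 1
        ring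
      have := hB _ _ (hf i) (e ▸ hf j)
      omega
    exact Set.infinite_of_injective_forall_mem hinj hfA hA
  let k : plus (universalGroup c F) :=
    ⟨m ^ i * h * (m ^ i)⁻¹, mul_mem (mul_mem (pow_mem hm i) hh) (inv_mem (pow_mem hm i))⟩
  have hk : k ∈ ({1} : Set (plus (universalGroup c F))) := by
    refine hs2 (hAs _ fun u hu => ?_)
    change (m ^ i) (h ((m ^ i)⁻¹ u)) = u
    rw [hs _ (hi u hu), mul_inv_apply]
  have hk' : m ^ i * h * (m ^ i)⁻¹ = 1 := congrArg Subtype.val hk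
  exact hh1 (conj_eq_one_iff.1 hk')

end Simplicity

end BurgerMozes

namespace BurgerMozes

/-! ### Frobenius kernels and their centralizers -/

section FrobeniusGroups

open Subgroup MulAction

theorem perm_smul_def {n : ℕ} {F : Subgroup (Equiv.Perm (Fin n))} (f : F) (i : Fin n) :
    f • i = (f : Equiv.Perm (Fin n)) i := rfl

theorem IsFrobenius.eq_one {n : ℕ} {F : Subgroup (Equiv.Perm (Fin n))} (hF : IsFrobenius F)
    {f : F} {i j : Fin n} (hij : i ≠ j) (hi : f • i = i) (hj : f • j = j) : f = 1 := by
  have : f ∈ stabilizer F i ⊓ stabilizer F j := ⟨hi, hj⟩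
  rw [hF.two_point i j hij] at this
  exact mem_bot.1 this

/-- In a Frobenius group whose point stabilizers have prime order `p` and index a power of a
prime different from `p`, the Frobenius kernel exists. -/
theorem IsFrobenius.exists_kernel {n : ℕ} {F : Subgroup (Equiv.Perm (Fin n))}
    (hF : IsFrobenius F) {p r : ℕ} (hp : p.Prime) (hr : r.Prime) (hrp : r ≠ p)
    (hcard : ∀ i : Fin n, Nat.card (stabilizer F i) = p)
    (hindex : ∀ i : Fin n, ∃ k : ℕ, (stabilizer F i).index = r ^ k) :
    ∃ Q : Subgroup F, Q.Normal ∧ Q.index = p ∧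
      (∀ q ∈ Q, ∀ i : Fin n, q • i = i → q = 1) ∧ ∀ i j : Fin n, ∃ q ∈ Q, q • i = j := by
  have := hF.transitive
  have := Fact.mk hr
  obtain ⟨b⟩ : Nonempty (Fin n) := by
    by_contra h
    exact hF.not_free fun i => (h ⟨i⟩).elim
  have hn : (stabilizer F b).index = n := by
    rw [index_stabilizer_of_transitive, Nat.card_fin]
  obtain ⟨k, hk⟩ := hindex b
  have hcF : Nat.card F = p * n := by
    have h := (stabilizer F b).card_mul_index
    rw [hn, hcard b] at h
    exact h.symm
  have hnk : n = r ^ k := hn.symm.trans hk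
  -- The group has order `p * n` with `n` a power of `r`, so a Sylow `r`-subgroup has order `n`. By
  -- coprimality it acts freely, hence regularly.
  obtain ⟨P, hcP⟩ : ∃ P : Subgroup F, Nat.card P = n := by
    obtain ⟨P⟩ : Nonempty (Sylow r F) := inferInstance
    refine ⟨P, ?_⟩
    rw [P.card_eq_multiplicity, hcF, hnk, Nat.factorization_mul hp.ne_zero (by
      exact pow_ne_zero _ hr.ne_zero), hp.factorization, hr.factorization_pow]
    simp [hrp]
  have hfree : ∀ q ∈ P, ∀ i : Fin n, q • i = i → q = 1 := by
    intro q hq i hi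
    have hcop : Nat.Coprime (Nat.card P) (Nat.card (stabilizer F i)) := by
      rw [hcP, hcard i, hnk]
      exact Nat.Coprime.pow_left k ((Nat.coprime_primes hr hp).2 hrp)
    have hbot := (Subgroup.disjoint_of_coprime_natCard hcop).eq_bot
    have : q ∈ P ⊓ stabilizer F i := ⟨hq, hi⟩
    rw [hbot] at this
    exact mem_bot.1 this
  have htrans : ∀ i j : Fin n, ∃ q ∈ P, q • i = j := by
    intro i j
    have hinj : Function.Injective fun q : P => (q : F) • i := by
      intro q q' h
      have h1 := hfree (q'⁻¹ * q : P) (q'⁻¹ * q).2 i (by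
        change ((q' : F)⁻¹ * (q : F)) • i = i
        rw [mul_smul, inv_smul_eq_iff]
        exact h)
      have h2 : q'⁻¹ * q = 1 := Subtype.ext h1
      exact (inv_mul_eq_one.1 h2).symm
    have hbij := hinj.bijective_of_nat_card_le (by rw [hcP, Nat.card_fin])
    obtain ⟨q, hq⟩ := hbij.2 j
    exact ⟨q, q.2, hq⟩
  -- For `f` outside `P`, choose `q i` in `P` such that `f * q i` fixes `i`. A coincidence `q i = q
  -- j` with `i ≠ j` gives `f * q i = 1`, which is excluded; so `q` is bijective onto `P` and takes
  -- the value 1. Normality follows: a conjugate of `q` outside `P` would fix a point, and so would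
  -- `q`.
  have hout : ∀ f ∉ P, ∃ i : Fin n, f • i = i := by
    intro f hf
    choose q hq hqi using fun i : Fin n => htrans i (f⁻¹ • i)
    have hinj : Function.Injective fun i : Fin n => (⟨q i, hq i⟩ : P) := by
      intro i j hij
      have hij' : q i = q j := congrArg Subtype.val hij
      by_contra hne
      have h1 : (f * q i) • i = i := by rw [mul_smul, hqi, smul_inv_smul]
      have h2 : (f * q i) • j = j := by rw [hij', mul_smul, hqi, smul_inv_smul]
      have h3 := hF.eq_one hne h1 h2
      rw [eq_inv_of_mul_eq_one_left h3] at hf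
      exact hf (inv_mem (hq i))
    have hbij := hinj.bijective_of_nat_card_le (by rw [hcP, Nat.card_fin])
    obtain ⟨i, hi⟩ := hbij.2 1
    refine ⟨i, ?_⟩
    have h1 : q i = 1 := congrArg Subtype.val hi
    have h2 := hqi i
    rw [h1, one_smul] at h2
    conv_lhs => rw [h2]
    exact smul_inv_smul f i
  refine ⟨P, ⟨fun q hq g => ?_⟩, ?_, hfree, htrans⟩
  · by_contra hcon
    obtain ⟨i, hi⟩ := hout _ hcon
    have h1 : q • (g⁻¹ • i) = g⁻¹ • i := by
      rw [eq_inv_smul_iff, ← mul_smul, ← mul_smul]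
      exact hi
    rw [hfree q hq _ h1] at hcon
    exact hcon (by simp)
  · have h1 := P.card_mul_index
    rw [hcP, hcF, mul_comm p n] at h1
    have hn0 : 0 < n := Fin.pos b
    exact Nat.eq_of_mul_eq_mul_left hn0 h1

/-- The data extracted from a Frobenius group with complement cyclic of prime order: the
projection `χ` to the cyclic group generated by a given permutation `σ`, with an element `gen` over
`σ`, and a transitive group `Z` of permutations commuting with the kernel of `χ`, on which taking
commutators with `gen` is surjective. -/
structure KernelData {n d : ℕ} (F : Subgroup (Equiv.Perm (Fin n))) (σ : Equiv.Perm (Fin d)) where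
  χ : F →* Equiv.Perm (Fin d)
  χ_mem : ∀ f, χ f ∈ zpowers σ
  gen : F
  χ_gen : χ gen = σ
  Z : Subgroup (Equiv.Perm (Fin n))
  commute : ∀ f, χ f = 1 → ∀ ζ ∈ Z, (f : Equiv.Perm (Fin n)) * ζ = ζ * f
  transitive : ∀ i j, ∃ ζ ∈ Z, ζ i = j
  surj : ∀ t ∈ Z, ∃ ζ ∈ Z, ζ⁻¹ * gen * ζ * (gen : Equiv.Perm (Fin n))⁻¹ = t

/-- The quotient by the kernel Q has prime order `p`, hence is isomorphic to ⟨σ⟩. The element over σ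
is chosen in a point stabilizer: having a single fixed point, it commutes with no nontrivial element
of Q or of the centralizer of Q. Injectivity of commutation then gives surjectivity by finiteness.
-/
theorem IsFrobenius.exists_kernelData {n d : ℕ} {F : Subgroup (Equiv.Perm (Fin n))}
    (hF : IsFrobenius F) {p r : ℕ} (hp : p.Prime) (hr : r.Prime) (hrp : r ≠ p)
    (hcard : ∀ i : Fin n, Nat.card (stabilizer F i) = p)
    (hindex : ∀ i : Fin n, ∃ k : ℕ, (stabilizer F i).index = r ^ k)
    {σ : Equiv.Perm (Fin d)} (hσ : orderOf σ = p) :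
    Nonempty (KernelData F σ) ∧ IsAdmissible F := by
  obtain ⟨Q, hQ, hQi, hfree, htrans⟩ := hF.exists_kernel hp hr hrp hcard hindex
  have := Fact.mk hp
  obtain ⟨b⟩ : Nonempty (Fin n) := by
    by_contra h
    exact hF.not_free fun i => (h ⟨i⟩).elim
  let e : F ⧸ Q ≃* zpowers σ := mulEquivOfPrimeCardEq (p := p)
    (by rw [← hQi]; rfl) (by rw [Nat.card_zpowers, hσ])
  let χ : F →* Equiv.Perm (Fin d) :=
    (zpowers σ).subtype.comp (e.toMonoidHom.comp (QuotientGroup.mk' Q))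
  have hχ : ∀ f, χ f = e (QuotientGroup.mk' Q f) := fun _ => rfl
  have hker : ∀ f, χ f = 1 → f ∈ Q := by
    intro f hf
    rw [hχ, OneMemClass.coe_eq_one, map_eq_one_iff e e.injective] at hf
    exact (QuotientGroup.eq_one_iff f).1 hf
  have hker' : ∀ f ∈ Q, χ f = 1 := by
    intro f hf
    rw [hχ, OneMemClass.coe_eq_one, map_eq_one_iff e e.injective]
    exact (QuotientGroup.eq_one_iff f).2 hf
  obtain ⟨f₀, hf₀⟩ : ∃ f₀, χ f₀ = σ := by
    obtain ⟨x, hx⟩ := e.surjective ⟨σ, mem_zpowers σ⟩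
    obtain ⟨f, rfl⟩ := QuotientGroup.mk'_surjective Q x
    exact ⟨f, by rw [hχ, hx]⟩
  -- Correcting by an element of the kernel makes the element over σ fix `b`.
  obtain ⟨q₀, hq₀, hq₀b⟩ := htrans (f₀ • b) b
  let g : F := q₀ * f₀
  have hgb : g • b = b := by rw [mul_smul, hq₀b]
  have hχg : χ g = σ := by rw [map_mul, hker' q₀ hq₀, one_mul, hf₀]
  have hg1 : g ≠ 1 := by
    intro h
    rw [h, map_one] at hχg
    rw [← hχg, orderOf_one] at hσ
    exact hp.one_lt.ne hσ
  have hgfix : ∀ i : Fin n, g • i = i → i = b := by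
    intro i hi
    by_contra hne
    exact hg1 (hF.eq_one hne hi hgb)
  have hinjQ : Function.Injective fun t : Q => (⟨g * t * g⁻¹ * t⁻¹,
      mul_mem (hQ.conj_mem t t.2 g) (inv_mem t.2)⟩ : Q) := by
    intro t s h
    have h0 : g * t * g⁻¹ * (t : F)⁻¹ = g * s * g⁻¹ * (s : F)⁻¹ := congrArg Subtype.val h
    have h1 : g * ((s : F)⁻¹ * t) = (s : F)⁻¹ * t * g := by
      have h2 : (t : F) * g⁻¹ * (t : F)⁻¹ = s * g⁻¹ * (s : F)⁻¹ := by
        simpa [mul_assoc] using h0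
      have h3 : (t : F) * g * (t : F)⁻¹ = s * g * (s : F)⁻¹ := by
        simpa [mul_assoc] using congrArg (·⁻¹) h2
      calc g * ((s : F)⁻¹ * t) = (s : F)⁻¹ * (s * g * (s : F)⁻¹) * t := by group
        _ = (s : F)⁻¹ * t * g := by rw [← h3]; group
    have h2 : g • ((s : F)⁻¹ * t) • b = ((s : F)⁻¹ * t) • b := by
      rw [← mul_smul, h1, mul_smul, hgb]
    have h3 := hfree _ (mul_mem (inv_mem s.2) t.2) b (hgfix _ h2)
    exact Subtype.ext (inv_mul_eq_one.1 h3).symm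
  have hsurjQ := Finite.surjective_of_injective hinjQ
  have hsingle : ∀ k, ∃ f ∈ F, f k = k ∧ ∀ i, i ≠ k → f i ≠ i := by
    intro k
    have : Nontrivial (stabilizer F k) := by
      rw [← Finite.one_lt_card_iff_nontrivial, hcard k]
      exact hp.one_lt
    obtain ⟨⟨f, hf⟩, hf1⟩ := exists_ne (1 : stabilizer F k)
    exact ⟨f, f.2, hf, fun i hi hfi => hf1 (Subtype.ext (hF.eq_one hi hfi hf))⟩
  -- Q is regular, so matching its orbit maps at `i` and at `j` gives a permutation that commutes
  -- with Q and sends `i` to `j`.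
  have htransZ : ∀ i j : Fin n, ∃ ζ : Equiv.Perm (Fin n),
      (∀ q ∈ Q, (q : Equiv.Perm (Fin n)) * ζ = ζ * q) ∧ ζ i = j := by
    intro i j
    have hbij : ∀ i : Fin n, Function.Bijective fun q : Q => (q : F) • i := by
      refine fun i => ⟨fun q q' h => ?_, fun j => ?_⟩
      · have h1 := hfree (q'⁻¹ * q : Q) (q'⁻¹ * q).2 i (by
          change ((q' : F)⁻¹ * (q : F)) • i = i
          rw [mul_smul, inv_smul_eq_iff]
          exact h)
        have h2 : q'⁻¹ * q = 1 := Subtype.ext h1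
        exact (inv_mul_eq_one.1 h2).symm
      · obtain ⟨q, hq, h⟩ := htrans i j
        exact ⟨⟨q, hq⟩, h⟩
    let ε : Fin n → Q ≃ Fin n := fun i => Equiv.ofBijective _ (hbij i)
    have hζ : ∀ q : Q, ((ε i).symm.trans (ε j)) ((q : F) • i) = (q : F) • j := by
      intro q
      have : (ε i).symm ((q : F) • i) = q := (ε i).symm_apply_eq.2 rfl
      rw [Equiv.trans_apply, this]
      rfl
    refine ⟨(ε i).symm.trans (ε j), fun q hq => Equiv.ext fun k => ?_, ?_⟩
    · obtain ⟨q', rfl⟩ := (hbij i).2 k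
      change q • (((ε i).symm.trans (ε j)) ((q' : F) • i)) =
        ((ε i).symm.trans (ε j)) (q • (q' : F) • i)
      rw [hζ, ← mul_smul, ← mul_smul]
      exact (hζ (⟨q, hq⟩ * q')).symm
    · simpa using hζ 1
  let Z : Subgroup (Equiv.Perm (Fin n)) := centralizer (Q.map F.subtype)
  have hZ : ∀ {ζ}, ζ ∈ Z ↔ ∀ q ∈ Q, (q : Equiv.Perm (Fin n)) * ζ = ζ * q := by
    intro ζ
    simp only [Z, mem_centralizer_iff, SetLike.mem_coe]
    constructor
    · exact fun h q hq => h _ (mem_map_of_mem _ hq)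
    · rintro h _ ⟨q, hq, rfl⟩
      exact h q hq
  have hZb : ∀ ζ ∈ Z, ζ b = b → ζ = 1 := by
    intro ζ hζ hb
    ext i
    obtain ⟨q, hq, rfl⟩ := htrans b i
    have := congrArg (fun τ : Equiv.Perm (Fin n) => τ b) (hZ.1 hζ q hq)
    simp only [Equiv.Perm.mul_apply, hb] at this
    rw [perm_smul_def, ← this]
    rfl
  have hZconj : ∀ ζ ∈ Z, (g : Equiv.Perm (Fin n)) * ζ * (g : Equiv.Perm (Fin n))⁻¹ ∈ Z := by
    intro ζ hζ
    refine hZ.2 fun q hq => ?_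
    have h1 := hZ.1 hζ (g⁻¹ * q * g) (by simpa using hQ.conj_mem q hq g⁻¹)
    simp only [Subgroup.coe_mul, Subgroup.coe_inv] at h1
    calc (q : Equiv.Perm (Fin n)) * (g * ζ * (g : Equiv.Perm (Fin n))⁻¹)
        = g * ((g : Equiv.Perm (Fin n))⁻¹ * q * g * ζ) * (g : Equiv.Perm (Fin n))⁻¹ := by group
      _ = g * ζ * (g : Equiv.Perm (Fin n))⁻¹ * q := by rw [h1]; group
  have hinjZ : Function.Injective fun ζ : Z =>
      (⟨(ζ : Equiv.Perm (Fin n))⁻¹ * g * ζ * (g : Equiv.Perm (Fin n))⁻¹, by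
        rw [mul_assoc, mul_assoc, ← mul_assoc (g : Equiv.Perm (Fin n))]
        exact mul_mem (inv_mem ζ.2) (hZconj ζ ζ.2)⟩ : Z) := by
    intro ζ η h
    have h0 : (ζ : Equiv.Perm (Fin n))⁻¹ * g * ζ = (η : Equiv.Perm (Fin n))⁻¹ * g * η :=
      mul_right_cancel (congrArg Subtype.val h)
    have h1 : (g : Equiv.Perm (Fin n)) * (ζ * (η : Equiv.Perm (Fin n))⁻¹) =
        ζ * (η : Equiv.Perm (Fin n))⁻¹ * g := by
      calc (g : Equiv.Perm (Fin n)) * (ζ * (η : Equiv.Perm (Fin n))⁻¹)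
          = ζ * ((ζ : Equiv.Perm (Fin n))⁻¹ * g * ζ) * (η : Equiv.Perm (Fin n))⁻¹ := by group
        _ = ζ * (η : Equiv.Perm (Fin n))⁻¹ * g := by rw [h0]; group
    have h2 := congrArg (fun τ : Equiv.Perm (Fin n) => τ b) h1
    have hgb' : (g : Equiv.Perm (Fin n)) b = b := hgb
    simp only [Equiv.Perm.mul_apply, hgb'] at h2
    have h3 := hZb _ (mul_mem ζ.2 (inv_mem η.2)) (hgfix _ h2)
    exact Subtype.ext (mul_inv_eq_one.1 h3)
  have hsurjZ := Finite.surjective_of_injective hinjZ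
  refine ⟨⟨⟨χ, fun f => (e _).2, g, hχg, Z, fun f hf ζ hζ => hZ.1 hζ f (hker f hf), ?_, ?_⟩⟩,
    ?_, ?_, hsingle⟩
  · intro i j
    obtain ⟨ζ, h1, h2⟩ := htransZ i j
    exact ⟨ζ, hZ.2 h1, h2⟩
  · intro t ht
    obtain ⟨ζ, hζ⟩ := hsurjZ ⟨t, ht⟩
    exact ⟨ζ, ζ.2, congrArg Subtype.val hζ⟩
  · obtain ⟨f, hf, hfb, hfi⟩ := hsingle b
    obtain ⟨i, hi⟩ : ∃ i, i ≠ b := by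
      by_contra! h
      exact hg1 (Subtype.ext (Equiv.ext fun i => (h _).trans (h _).symm))
    have h1 := hfi i hi
    have h2 : f i ≠ b := fun h => hi (f.injective (h.trans hfb.symm))
    rw [Ne, Fin.ext_iff] at h1 h2 hi
    omega
  · intro i j
    obtain ⟨q, hq, hqi⟩ := htrans i j
    refine ⟨q, ?_, hqi⟩
    obtain ⟨t, ht⟩ := hsurjQ ⟨q, hq⟩
    have ht' : g * t * g⁻¹ * (t : F)⁻¹ = q := congrArg Subtype.val ht
    rw [← ht']
    -- Each element of Q is a commutator with `g`, hence a product of `g`, fixing `b`, and a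
    -- conjugate of `g⁻¹`, fixing `t • b`. Thus the point stabilizers generate a transitive group.
    have e1 : ((g * t * g⁻¹ * (t : F)⁻¹ : F) : Equiv.Perm (Fin n)) =
      (g : Equiv.Perm (Fin n)) * ((t * g⁻¹ * (t : F)⁻¹ : F) : Equiv.Perm (Fin n)) := by
      simp [mul_assoc]
    rw [e1]
    refine mul_mem (subset_closure ⟨g.2, b, hgb⟩) (subset_closure ⟨Subtype.prop _, (t : F) • b, ?_⟩)
    change (t * g⁻¹ * (t : F)⁻¹ : F) • (t : F) • b = (t : F) • b
    rw [mul_smul, inv_smul_smul, mul_smul, inv_smul_eq_iff.2 hgb.symm]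

/-- In a group of prime order a nontrivial `τ` generates, so σ would fix whatever `τ` fixes. -/
theorem eq_one_of_mem_zpowers {d : ℕ} {σ τ : Equiv.Perm (Fin d)} (hσ : (orderOf σ).Prime)
    {o : Fin d} (ho : σ o ≠ o) (hτ : τ ∈ zpowers σ) (hτo : τ o = o) : τ = 1 := by
  obtain ⟨m, rfl⟩ := mem_zpowers_iff.1 hτ
  by_contra hne
  have hm : ¬ ((orderOf σ : ℤ) ∣ m) := fun h => hne (orderOf_dvd_iff_zpow_eq_one.1 h)
  have hcop : IsCoprime (orderOf σ : ℤ) m :=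
    (Nat.prime_iff_prime_int.1 hσ).irreducible.coprime_iff_not_dvd.2 hm
  obtain ⟨u, v, huv⟩ := hcop
  have h1 : σ = (σ ^ m) ^ v := by
    rw [← zpow_mul]
    conv_lhs => rw [← zpow_one σ, ← huv, zpow_add, mul_comm u, zpow_mul, zpow_natCast,
      pow_orderOf_eq_one, one_zpow, one_mul, mul_comm]
  have h2 : (σ ^ m) ^ v ∈ stabilizer (Equiv.Perm (Fin d)) o := zpow_mem hτo v
  rw [← h1] at h2
  exact ho h2

end FrobeniusGroups

end BurgerMozes

namespace BurgerMozes

universe u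

open Filter Topology

/-! ### Compact generation from finitely many vertex orbits -/

section CompactGeneration

variable {V : Type u} {T : SimpleGraph V}

/-- A closed group of automorphisms of a locally finite connected graph with finitely many orbits
of vertices is compactly generated. -/
theorem isCompactlyGenerated_of_finite_orbits (hT : T.Connected)
    (hfin : ∀ v, (T.neighborSet v).Finite) {H : Subgroup (T ≃g T)}
    (hH : IsClosed (H : Set (T ≃g T))) {A : Set V} (hA : A.Finite)
    (horb : ∀ v, ∃ h ∈ H, ∃ a ∈ A, h a = v) : IsCompactlyGenerated H := by
  obtain ⟨v₀⟩ := hT.nonempty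
  obtain ⟨-, -, a₀, ha₀, -⟩ := horb v₀
  let B : Set V := A ∪ ⋃ a ∈ A, T.neighborSet a
  have hB : B.Finite := hA.union (hA.biUnion fun a _ => hfin a)
  -- Elements taking a representative to a representative or to a neighbour of one; these lead from
  -- any vertex already reached to its neighbours.
  let K : Set H := ⋃ a ∈ A, ⋃ b ∈ B, Subtype.val ⁻¹' {g : T ≃g T | g a = b}
  have hKmem : ∀ (h : H) (a b : V), a ∈ A → b ∈ B → (h : T ≃g T) a = b →
      h ∈ Subgroup.closure K := fun h a b ha hb hab =>
    Subgroup.subset_closure (Set.mem_biUnion ha (Set.mem_biUnion hb hab))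
  have hreach : ∀ v, ∃ k ∈ Subgroup.closure K, ∃ a ∈ A, (k : T ≃g T) a = v := by
    refine forall_of_adj hT a₀ ⟨1, one_mem _, a₀, ha₀, rfl⟩ ?_
    rintro _ v' hadj ⟨k, hk, a, ha, rfl⟩
    obtain ⟨h, hh, a', ha', hv'⟩ := horb ((k : T ≃g T)⁻¹ v')
    have hadj' : T.Adj a (h a') := by
      rw [hv', ← (k : T ≃g T).map_adj_iff, mul_inv_apply]
      exact hadj
    have hhK := hKmem ⟨h, hh⟩ a' (h a') ha' (Or.inr (Set.mem_biUnion ha hadj')) rfl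
    refine ⟨k * ⟨h, hh⟩, mul_mem hk hhK, a', ha', ?_⟩
    change (k : T ≃g T) (h a') = v'
    rw [hv', mul_inv_apply]
  refine ⟨K, ?_, eq_top_iff.2 fun h _ => ?_⟩
  · exact hA.isCompact_biUnion fun a _ => hB.isCompact_biUnion fun b _ =>
      hH.isClosedEmbedding_subtypeVal.isCompact_preimage (isCompact_setOf_apply_eq hT hfin a b)
  · obtain ⟨k, hk, a, ha, hka⟩ := hreach ((h : T ≃g T) a₀)
    have h1 : k⁻¹ * h ∈ Subgroup.closure K := hKmem _ a₀ a ha₀ (Or.inl ha) (by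
      change (k : T ≃g T)⁻¹ ((h : T ≃g T) a₀) = a
      rw [← hka, inv_mul_apply])
    have := mul_mem hk h1
    rwa [mul_inv_cancel_left] at this

end CompactGeneration

/-! ### Lifting a cocycle action to the universal cover -/

section Lifting

/-- A topological group `G` acting on a set `X` with `d` involutions that are permuted by the action
through a cocycle with values in a permutation group `F`. The involutions act transitively, `G` has
finitely many orbits, and its topology is that of pointwise convergence. -/
structure CocycleAction (G : Type*) [Group G] [TopologicalSpace G] (X : Type*) [MulAction G X]
    {d : ℕ} (F : Subgroup (Equiv.Perm (Fin d))) where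
  /-- the involutions -/
  ι : Fin d → X → X
  /-- the cocycle -/
  s : G → X → Equiv.Perm (Fin d)
  nonempty : Nonempty X
  involutive : ∀ j x, ι j (ι j x) = x
  cocycle : ∀ g h x, s (g * h) x = s g (h • x) * s h x
  s_mem : ∀ g x, s g x ∈ F
  -- The involutions are the colored edges of a graph on `X`, and `s g x` plays the role of the
  -- local action of `g` at `x`; `s_ι` says that both ends of an edge give it the same new color.
  smul_ι : ∀ g j x, g • ι j x = ι (s g x j) (g • x)
  s_ι : ∀ g j x, s g (ι j x) j = s g x j
  connected : ∀ S : Set X, S.Nonempty → (∀ j, ∀ x ∈ S, ι j x ∈ S) → S = Set.univ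
  faithful : ∀ g h : G, (∀ x : X, g • x = h • x) → g = h
  eventually_smul : ∀ (g : G) (x : X), ∀ᶠ h in 𝓝 g, h • x = g • x
  eventually_s : ∀ (g : G) (x : X), ∀ᶠ h in 𝓝 g, s h x = s g x
  le_nhds : ∀ g : G, ⨅ x : X, 𝓟 {h : G | h • x = g • x} ≤ 𝓝 g
  complete : ∀ l : Filter G, l.NeBot → (∀ x : X, ∃ x', ∀ᶠ g in l, g • x = x') →
    (∀ x : X, ∃ x', ∀ᶠ g in l, g⁻¹ • x = x') → ∃ g, l ≤ 𝓝 g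
  finite_orbits : ∃ A : Set X, A.Finite ∧ ∀ x, ∃ g : G, g • x ∈ A

namespace CocycleAction

variable {V : Type u} {T : SimpleGraph V} {d : ℕ} {c : RegularColoring T d}
  {F : Subgroup (Equiv.Perm (Fin d))} {G : Type*} [Group G] [TopologicalSpace G]
  {X : Type*} [MulAction G X] (E : CocycleAction G X F)

theorem s_one (x : X) : E.s 1 x = 1 := by
  have h := E.cocycle 1 1 x
  rw [mul_one, one_smul] at h
  exact mul_eq_left.1 h.symm

/-- The automorphism `h` of the tree lies over the element `g` of the group. -/
def IsLift (c : RegularColoring T d) (π : V → X) (h : T ≃g T) (g : G) : Prop :=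
  ∀ t, π (h t) = g • π t ∧ c.localAction h t = E.s g (π t)

variable {E} {π : V → X}

theorem IsLift.one : E.IsLift c π 1 1 := fun t =>
  ⟨(one_smul G _).symm, by rw [c.localAction_one, E.s_one]⟩

theorem IsLift.mul {h h' : T ≃g T} {g g' : G} (H : E.IsLift c π h g) (H' : E.IsLift c π h' g') :
    E.IsLift c π (h * h') (g * g') := fun t => by
  constructor
  · rw [mul_apply_aut, (H _).1, (H' t).1, mul_smul]
  · rw [c.localAction_mul, (H _).2, (H' t).2, (H' t).1, E.cocycle]

theorem IsLift.inv {h : T ≃g T} {g : G} (H : E.IsLift c π h g) : E.IsLift c π h⁻¹ g⁻¹ := fun t => by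
  have h1 : π (h⁻¹ t) = g⁻¹ • π t := by
    rw [eq_inv_smul_iff, ← (H _).1, mul_inv_apply]
  refine ⟨h1, ?_⟩
  have e1 := c.localAction_mul h h⁻¹ t
  rw [mul_inv_cancel, c.localAction_one, (H _).2, h1] at e1
  have e2 := E.cocycle g g⁻¹ (π t)
  rw [mul_inv_cancel, E.s_one] at e2
  exact mul_left_cancel (e1.symm.trans e2)

theorem IsLift.unique (hπ : Function.Surjective π) {h : T ≃g T} {g g' : G}
    (H : E.IsLift c π h g) (H' : E.IsLift c π h g') : g = g' :=
  E.faithful g g' fun x => by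
    obtain ⟨t, rfl⟩ := hπ x
    rw [← (H t).1, ← (H' t).1]

/-- The cocycle, read along `π`, is a compatible family of local actions by `s_ι`. That the
resulting automorphism covers `g` propagates along edges by `smul_ι`. -/
theorem exists_isLift (hT : T.IsTree) (hc : c.IsLegal) (hι : ∀ t j, π (c.nb t j) = E.ι j (π t))
    {g : G} {t t' : V} (h : π t' = g • π t) : ∃ k : T ≃g T, k t = t' ∧ E.IsLift c π k g := by
  obtain ⟨k, hk, hs⟩ := c.exists_iso_localAction hT hc (fun v => E.s g (π v))
    (fun v j => by rw [hι, E.s_ι]) t t'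
  refine ⟨k, hk, fun v => ⟨?_, hs v⟩⟩
  refine forall_of_adj hT.connected (P := fun v => π (k v) = g • π v) t (by rw [hk, h]) ?_ v
  intro v w hvw hv
  obtain ⟨j, rfl⟩ := c.exists_nb hvw
  rw [c.apply_nb, hι, hι, E.smul_ι, hv, hs]

theorem exists_developing (E : CocycleAction G X F) (hT : T.IsTree) (hc : c.IsLegal) :
    ∃ π : V → X, Function.Surjective π ∧ ∀ t j, π (c.nb t j) = E.ι j (π t) := by
  obtain ⟨t₀⟩ := hT.connected.nonempty
  obtain ⟨x₀⟩ := E.nonempty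
  obtain ⟨π, -, hπ⟩ := c.exists_development hT hc t₀ x₀ (fun _ => E.ι)
    (fun _ j x => E.involutive j x)
  refine ⟨π, Set.range_eq_univ.1 (E.connected _ ⟨π t₀, t₀, rfl⟩ ?_), hπ⟩
  rintro j _ ⟨t, rfl⟩
  exact ⟨c.nb t j, hπ t j⟩

/-- The group of all automorphisms of the tree lying over elements of `G`. -/
def liftGroup (E : CocycleAction G X F) (c : RegularColoring T d) (π : V → X) :
    Subgroup (T ≃g T) where
  carrier := {h | ∃ g, E.IsLift c π h g}
  one_mem' := ⟨1, IsLift.one⟩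
  mul_mem' := fun ⟨g, hg⟩ ⟨g', hg'⟩ => ⟨g * g', hg.mul hg'⟩
  inv_mem' := fun ⟨g, hg⟩ => ⟨g⁻¹, hg.inv⟩

/-- The projection of the group of lifts. -/
noncomputable def proj (E : CocycleAction G X F) (c : RegularColoring T d) {π : V → X}
    (hπ : Function.Surjective π) : E.liftGroup c π →* G :=
  MonoidHom.mk' (fun h => h.2.choose) fun h h' =>
    IsLift.unique hπ (h * h').2.choose_spec (h.2.choose_spec.mul h'.2.choose_spec)

variable (hπ : Function.Surjective π)

theorem isLift_proj (h : E.liftGroup c π) : E.IsLift c π h (E.proj c hπ h) := h.2.choose_spec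

theorem proj_eq {h : E.liftGroup c π} {g : G} (H : E.IsLift c π h g) : E.proj c hπ h = g :=
  (isLift_proj hπ h).unique hπ H

theorem eventually_val_apply (h : E.liftGroup c π) (t : V) :
    ∀ᶠ k : E.liftGroup c π in 𝓝 h, (k : T ≃g T) t = (h : T ≃g T) t :=
  continuous_subtype_val.continuousAt.eventually (eventually_apply_eq (h : T ≃g T) t)

theorem tendsto_proj {l : Filter (E.liftGroup c π)} {g : G}
    (H : ∀ t, ∀ᶠ h in l, E.proj c hπ h • π t = g • π t) : Tendsto (E.proj c hπ) l (𝓝 g) := by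
  refine le_trans ?_ (E.le_nhds g)
  refine le_iInf fun x => le_principal_iff.2 ?_
  obtain ⟨t, rfl⟩ := hπ x
  exact H t

theorem continuous_proj : Continuous (E.proj c hπ) :=
  continuous_iff_continuousAt.2 fun h => tendsto_proj hπ fun t => by
    filter_upwards [eventually_val_apply h t] with k hk
    rw [← (isLift_proj hπ k t).1, ← (isLift_proj hπ h t).1, hk]

/-- As lifts converge, the elements below them and their inverses become constant on each point of
`X`. By `complete` they converge, and the limit of the lifts lies over their limit. -/
theorem isClosed_liftGroup (hπ : Function.Surjective π) : IsClosed (E.liftGroup c π : Set (T ≃g T)) := by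
  refine isClosed_of_closure_subset fun h₀ hh₀ => ?_
  let l : Filter (E.liftGroup c π) := comap Subtype.val (𝓝 h₀)
  have hl : l.NeBot := mem_closure_iff_comap_neBot.1 hh₀
  have hval : Tendsto (fun h : E.liftGroup c π => (h : T ≃g T)) l (𝓝 h₀) := tendsto_comap
  have h1 := tendsto_aut.1 hval
  have h2 := tendsto_aut.1 hval.inv
  obtain ⟨g, hg⟩ := E.complete (map (E.proj c hπ) l) inferInstance
    (fun x => by
      obtain ⟨t, rfl⟩ := hπ x
      refine ⟨π (h₀ t), ?_⟩
      rw [eventually_map]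
      filter_upwards [h1 t] with h hh
      rw [← (isLift_proj hπ h t).1, hh])
    (fun x => by
      obtain ⟨t, rfl⟩ := hπ x
      refine ⟨π (h₀⁻¹ t), ?_⟩
      rw [eventually_map]
      filter_upwards [h2 t] with h hh
      rw [← ((isLift_proj hπ h).inv t).1, hh])
  refine ⟨g, fun t => ?_⟩
  have h3 : ∀ᶠ h in l, E.proj c hπ h • π t = g • π t := hg (E.eventually_smul g (π t))
  have h4 : ∀ᶠ h in l, E.s (E.proj c hπ h) (π t) = E.s g (π t) := hg (E.eventually_s g (π t))
  have h5 : ∀ᶠ h : E.liftGroup c π in l, c.localAction (h : T ≃g T) t = c.localAction h₀ t :=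
    hval ((IsLocallyConstant.iff_eventually_eq _).1 (isLocallyConstant_localAction c t) h₀)
  obtain ⟨h, e1, e3, e4, e5⟩ := ((h1 t).and (h3.and (h4.and h5))).exists
  exact ⟨by rw [← e1, ← e3, (isLift_proj hπ h t).1], by rw [← e5, ← e4, (isLift_proj hπ h t).2]⟩

theorem surjective_proj (hT : T.IsTree) (hc : c.IsLegal)
    (hι : ∀ t j, π (c.nb t j) = E.ι j (π t)) : Function.Surjective (E.proj c hπ) := fun g => by
  obtain ⟨t⟩ := hT.connected.nonempty
  obtain ⟨t', ht'⟩ := hπ (g • π t)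
  obtain ⟨h, -, hh⟩ := exists_isLift hT hc hι ht'
  exact ⟨⟨h, g, hh⟩, proj_eq hπ hh⟩

/-- A lift is determined by the image of `t₀` and by the cocycle along paths. An element close to
`E.proj c hπ h` has the same cocycle along finitely many paths, so its lift agreeing with `h` at
`t₀` agrees with `h` on a given finite set. -/
theorem isOpenMap_proj (hT : T.IsTree) (hc : c.IsLegal)
    (hι : ∀ t j, π (c.nb t j) = E.ι j (π t)) : IsOpenMap (E.proj c hπ) := by
  refine isOpenMap_iff_nhds_le.2 fun h S hS => ?_
  obtain ⟨t₀⟩ := hT.connected.nonempty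
  rw [mem_map, mem_nhds_subtype] at hS
  obtain ⟨S', hS', hsub⟩ := hS
  obtain ⟨A, hA, hAS⟩ := exists_finite_of_mem_nhds hS'
  have key : ∀ t, ∀ᶠ g in 𝓝 (E.proj c hπ h), ∀ k : T ≃g T, E.IsLift c π k g →
      k t₀ = (h : T ≃g T) t₀ → k t = (h : T ≃g T) t := by
    refine forall_of_adj hT.connected t₀ (Eventually.of_forall fun _ _ _ => id) ?_
    intro t t' htt' ht
    obtain ⟨j, rfl⟩ := c.exists_nb htt'
    filter_upwards [ht, E.eventually_s (E.proj c hπ h) (π t)] with g hg hs k hk hk0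
    rw [c.apply_nb, c.apply_nb, hg k hk hk0, (hk t).2, (isLift_proj hπ h t).2, hs]
  filter_upwards [(eventually_all_finite hA).2 fun t _ => key t,
    E.eventually_smul (E.proj c hπ h) (π t₀)] with g hg hg0
  rw [← (isLift_proj hπ h t₀).1] at hg0
  obtain ⟨k, hk0, hk⟩ := exists_isLift hT hc hι hg0.symm
  have : (⟨k, g, hk⟩ : E.liftGroup c π) ∈ E.proj c hπ ⁻¹' S :=
    hsub (hAS k fun t ht => hg t ht k hk hk0)
  rw [Set.mem_preimage, proj_eq hπ (h := ⟨k, g, hk⟩) hk] at this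
  exact this

/-- Lifts of 1 have trivial local actions, so one fixing `t₀` is trivial, and the stabilizer of `t₀`
is open. -/
theorem discreteTopology_ker (hT : T.IsTree) : DiscreteTopology (E.proj c hπ).ker := by
  obtain ⟨t₀⟩ := hT.connected.nonempty
  refine discreteTopology_of_isOpen_singleton_one ?_
  have hopen : IsOpen {k : (E.proj c hπ).ker | ((k : E.liftGroup c π) : T ≃g T) t₀ = t₀} :=
    ((isLocallyConstant_apply t₀).isClopen_fiber t₀).2.preimage
      (continuous_subtype_val.comp continuous_subtype_val)
  convert hopen using 1
  ext k
  constructor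
  · rintro rfl
    rfl
  · intro hk
    refine Subtype.ext (Subtype.ext (RelIso.ext ?_))
    have hlift := isLift_proj hπ (k : E.liftGroup c π)
    rw [MonoidHom.mem_ker.1 k.2] at hlift
    refine forall_of_adj hT.connected t₀ hk fun t t' htt' ht => ?_
    obtain ⟨j, rfl⟩ := c.exists_nb htt'
    rw [c.apply_nb, (hlift t).2, E.s_one, ht]
    rfl

theorem liftGroup_le (c : RegularColoring T d) (π : V → X) :
    E.liftGroup c π ≤ universalGroup c F := by
  rintro h ⟨g, hg⟩ t
  rw [(hg t).2]
  exact E.s_mem g _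

/-- Vertices over the same orbit of `G` are related by a lift, so finitely many vertices represent
all orbits. -/
theorem isCompactlyGenerated_liftGroup (hπ : Function.Surjective π) (hT : T.IsTree) (hc : c.IsLegal)
    (hι : ∀ t j, π (c.nb t j) = E.ι j (π t)) : IsCompactlyGenerated (E.liftGroup c π) := by
  obtain ⟨A, hA, horb⟩ := E.finite_orbits
  choose f hf using hπ
  refine isCompactlyGenerated_of_finite_orbits hT.connected c.finite_neighborSet
    (isClosed_liftGroup fun x => ⟨f x, hf x⟩) (hA.image f) fun t => ?_
  obtain ⟨g, hg⟩ := horb (π t)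
  obtain ⟨h, h1, h2⟩ := exists_isLift hT hc hι (t := t) (t' := f (g • π t)) (g := g) (hf _)
  exact ⟨h⁻¹, ⟨g⁻¹, h2.inv⟩, _, Set.mem_image_of_mem f hg, inv_apply_eq.2 h1.symm⟩

/-- The quotient of the group of lifts by the kernel of the projection. -/
noncomputable def quotientEquiv (hT : T.IsTree) (hc : c.IsLegal)
    (hι : ∀ t j, π (c.nb t j) = E.ι j (π t)) :
    (E.liftGroup c π ⧸ (E.proj c hπ).ker) ≃ₜ* G :=
  { QuotientGroup.quotientKerEquivOfSurjective (E.proj c hπ) (surjective_proj hπ hT hc hι) with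
    continuous_toFun := (QuotientGroup.isQuotientMap_mk (E.proj c hπ).ker).continuous_iff.2 (continuous_proj hπ)
    continuous_invFun := by
      refine ((isOpenMap_proj hπ hT hc hι).isQuotientMap (continuous_proj hπ)
        (surjective_proj hπ hT hc hι)).continuous_iff.2 ?_
      convert (QuotientGroup.continuous_mk (N := (E.proj c hπ).ker)) using 1
      ext h
      exact (QuotientGroup.quotientKerEquivOfSurjective (E.proj c hπ)
        (surjective_proj hπ hT hc hι)).symm_apply_eq.2 rfl }

/-- A simple group with a cocycle action is a subquotient of the universal group. -/
theorem exists_isSimpleSubquotient (E : CocycleAction G X F) (hT : T.IsTree) (hc : c.IsLegal)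
    [IsSimpleGroup G] [T2Space G] [LocallyCompactSpace G] [TotallyDisconnectedSpace G]
    (hG : ¬ DiscreteTopology G) :
    ∃ (H : Subgroup (T ≃g T)) (D : Subgroup H) (_ : D.Normal),
      IsSimpleSubquotient (universalGroup c F) H D ∧ Nonempty ((H ⧸ D) ≃ₜ* G) := by
  obtain ⟨π, hπ, hι⟩ := exists_developing E hT hc
  let e := quotientEquiv hπ hT hc hι
  have hcg := isCompactlyGenerated_liftGroup hπ hT hc hι
  have hsimple : IsSimpleGroup (E.liftGroup c π ⧸ (E.proj c hπ).ker) :=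
    e.toMulEquiv.isSimpleGroup
  refine ⟨E.liftGroup c π, (E.proj c hπ).ker, inferInstance,
    ⟨liftGroup_le c π, isClosed_liftGroup hπ, hcg, discreteTopology_ker hπ hT, hsimple, ?_⟩, ⟨e⟩⟩
  refine ⟨inferInstance, e.toHomeomorph.symm.t2Space,
    e.toHomeomorph.isClosedEmbedding.locallyCompactSpace,
    e.toHomeomorph.symm.totallyDisconnectedSpace, fun h => hG ?_, ?_, ?_⟩
  · exact e.toHomeomorph.symm.isEmbedding.discreteTopology
  · obtain ⟨K, hK, hKtop⟩ := hcg
    refine ⟨QuotientGroup.mk' _ '' K, hK.image QuotientGroup.continuous_mk, ?_⟩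
    rw [← MonoidHom.map_closure, hKtop, ← MonoidHom.range_eq_map]
    exact MonoidHom.range_eq_top.2 (QuotientGroup.mk'_surjective _)
  · exact ⟨inferInstance, fun N hN _ => hN.eq_bot_or_eq_top⟩

end CocycleAction

end Lifting
end BurgerMozes

namespace BurgerMozes

universe u

open Filter Topology

/-! ### Equivariant families and the sequence that exhausts Z -/

namespace KernelData

variable {n d : ℕ} {F : Subgroup (Equiv.Perm (Fin n))} {σ : Equiv.Perm (Fin d)}
  (K : KernelData F σ)

/-- A permutation in `Z` extends to an equivariant family indexed by the colors. -/
theorem exists_equivariant (hσ : (orderOf σ).Prime) {o : Fin d} (ho : σ o ≠ o)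
    {ζ : Equiv.Perm (Fin n)} (hζ : ζ ∈ K.Z) :
    ∃ R : Fin d → Equiv.Perm (Fin n), R o = ζ ∧
      ∀ (f : F) j, R (K.χ f j) = f * R j * (f : Equiv.Perm (Fin n))⁻¹ := by
  classical
  -- On the orbit of `o` equivariance forces the value at `K.χ f o` to be the conjugate of `ζ` by
  -- `f`. It is well defined because `ζ` commutes with the kernel of `χ`. Off the orbit, 1 is
  -- equivariant.
  let R : Fin d → Equiv.Perm (Fin n) := fun j =>
    if h : ∃ f : F, K.χ f o = j then h.choose * ζ * (h.choose : Equiv.Perm (Fin n))⁻¹ else 1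
  have hR : ∀ f : F, R (K.χ f o) = f * ζ * (f : Equiv.Perm (Fin n))⁻¹ := by
    intro f
    have hex : ∃ f' : F, K.χ f' o = K.χ f o := ⟨f, rfl⟩
    have hf := hex.choose_spec
    simp only [R, dif_pos hex]
    generalize hex.choose = f' at hf
    have h1 : K.χ (f'⁻¹ * f) = 1 := by
      refine eq_one_of_mem_zpowers hσ ho (K.χ_mem _) ?_
      rw [map_mul, map_inv, Equiv.Perm.mul_apply, Equiv.Perm.inv_eq_iff_eq, hf]
    have h2 := K.commute _ h1 ζ hζ
    simp only [Subgroup.coe_mul, Subgroup.coe_inv] at h2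
    calc (f' : Equiv.Perm (Fin n)) * ζ * (f' : Equiv.Perm (Fin n))⁻¹
        = f' * (ζ * ((f' : Equiv.Perm (Fin n))⁻¹ * f)) * (f : Equiv.Perm (Fin n))⁻¹ := by group
      _ = f * ζ * (f : Equiv.Perm (Fin n))⁻¹ := by rw [← h2]; group
  refine ⟨R, by simpa using hR 1, fun f j => ?_⟩
  by_cases hj : ∃ f' : F, K.χ f' o = j
  · obtain ⟨f', rfl⟩ := hj
    have h1 := hR (f * f')
    rw [map_mul, Equiv.Perm.mul_apply] at h1
    rw [h1, hR, Subgroup.coe_mul]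
    group
  · have hj' : ¬ ∃ f' : F, K.χ f' o = K.χ f j := by
      rintro ⟨f', hf'⟩
      refine hj ⟨f⁻¹ * f', ?_⟩
      rw [map_mul, map_inv, Equiv.Perm.mul_apply, Equiv.Perm.inv_eq_iff_eq, hf']
    simp only [R, dif_neg hj, dif_neg hj']
    group

/-- A finite sequence in `Z` such that the commutators with `gen`, transported back to the start
of the sequence, exhaust `Z`. -/
theorem exists_sequence : ∃ (M : ℕ) (ζ : ℕ → Equiv.Perm (Fin n)), (∀ k, ζ k ∈ K.Z) ∧
    ∀ S : ℕ → Set (Fin n), (∀ k < M, ∀ i, i ∈ S k ↔ ζ k i ∈ S (k + 1)) →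
      (∀ k ≤ M, ∀ i ∈ S k,
        ((ζ k)⁻¹ * (K.gen * ζ k * (K.gen : Equiv.Perm (Fin n))⁻¹)) i ∈ S k) →
      (S 0).Nonempty → S 0 = Set.univ := by
  choose sec hsec using fun t : K.Z => K.surj t t.2
  obtain ⟨m, ⟨e⟩⟩ := Finite.exists_equiv_fin K.Z
  -- `u` enumerates `Z`, and `Ω k` is the product of the first `k` terms of the sequence,
  -- transporting `S 0` to `S k`. The next term is chosen so that its commutator with `gen` is `Ω k
  -- * u k * (Ω k)⁻¹`; transported back to `S 0` this is `u k`.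
  let u : ℕ → K.Z := fun k => if h : k < m then e.symm ⟨k, h⟩ else 1
  let step : ℕ → K.Z → K.Z := fun k Ω => ⟨sec (Ω * u k * Ω⁻¹), (hsec _).1⟩
  let Ω : ℕ → K.Z := fun k => Nat.rec (motive := fun _ => K.Z) 1 (fun k Ω => step k Ω * Ω) k
  have hΩ : ∀ k, (Ω (k + 1) : K.Z) = (step k (Ω k) : K.Z) * Ω k := fun _ => rfl
  refine ⟨m, fun k => ((step k (Ω k) : K.Z) : Equiv.Perm (Fin n)), fun k => Subtype.prop _, fun S h1 h2 ⟨i, hi⟩ => ?_⟩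
  have hS : ∀ k ≤ m, ∀ i, i ∈ S 0 ↔ (Ω k : Equiv.Perm (Fin n)) i ∈ S k := by
    intro k
    induction k with
    | zero => exact fun _ i => Iff.rfl
    | succ k ih =>
      intro hk i
      rw [ih (by omega) i, h1 k (by omega), hΩ]
      rfl
  refine Set.eq_univ_of_forall fun j => ?_
  obtain ⟨ζ, hζ, rfl⟩ := K.transitive i j
  obtain ⟨k, hk, hu⟩ : ∃ k < m, u k = ⟨ζ, hζ⟩ :=
    ⟨e ⟨ζ, hζ⟩, (e ⟨ζ, hζ⟩).2, by simp [u]⟩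
  have h3 := h2 k hk.le _ ((hS k hk.le i).1 hi)
  have h4 : (step k (Ω k) : Equiv.Perm (Fin n))⁻¹ *
      (K.gen * step k (Ω k) * (K.gen : Equiv.Perm (Fin n))⁻¹) = Ω k * ζ * (Ω k)⁻¹ := by
    have := (hsec (Ω k * u k * (Ω k)⁻¹)).2
    rw [hu] at this
    rw [← mul_assoc, ← mul_assoc]
    simpa [step, hu] using this
  rw [h4, Equiv.Perm.mul_apply, Equiv.Perm.mul_apply] at h3
  rw [hS k hk.le]
  simpa using h3

/-- The projection `χ`, extended by `1` to all permutations. -/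
noncomputable def χ' (f : Equiv.Perm (Fin n)) : Equiv.Perm (Fin d) :=
  open Classical in if h : f ∈ F then K.χ ⟨f, h⟩ else 1

theorem χ'_apply {f : Equiv.Perm (Fin n)} (hf : f ∈ F) : K.χ' f = K.χ ⟨f, hf⟩ := dif_pos hf

theorem χ'_mem (f : Equiv.Perm (Fin n)) : K.χ' f ∈ Subgroup.zpowers σ := by
  unfold χ'
  split_ifs
  · exact K.χ_mem _
  · exact one_mem _

theorem χ'_mul {f f' : Equiv.Perm (Fin n)} (hf : f ∈ F) (hf' : f' ∈ F) :
    K.χ' (f * f') = K.χ' f * K.χ' f' := by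
  rw [K.χ'_apply hf, K.χ'_apply hf', K.χ'_apply (mul_mem hf hf'), ← map_mul]
  rfl

theorem χ'_fix {a : Fin d} (ha : σ a = a) (f : Equiv.Perm (Fin n)) : K.χ' f a = a := by
  obtain ⟨m, hm⟩ := Subgroup.mem_zpowers_iff.1 (K.χ'_mem f)
  rw [← hm]
  have : σ ∈ MulAction.stabilizer (Equiv.Perm (Fin d)) a := ha
  exact zpow_mem this m

end KernelData

/-! ### The graph of flags and the action of U(F')⁺ on it -/

/-- A directed edge of a colored tree, given by its origin and its color, with a position on a
cycle of even length. -/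
@[ext]
structure Flag (W : Type*) (n M : ℕ) where
  /-- the origin of the edge -/
  vertex : W
  /-- the color of the edge -/
  color : Fin n
  /-- the position on the cycle -/
  level : Fin (M + 1)
  /-- the parity of the position -/
  side : Bool

namespace Flag

variable {W : Type u} {T : SimpleGraph W} {n M d : ℕ} (c : RegularColoring T n)

/-- The action of automorphisms on flags. -/
@[reducible]
noncomputable def mulAction (G : Subgroup (T ≃g T)) : MulAction G (Flag W n M) where
  smul g x := ⟨(g : T ≃g T) x.vertex, c.localAction g x.vertex x.color, x.level, x.side⟩
  one_smul x := by
    change (⟨(1 : T ≃g T) x.vertex, c.localAction 1 x.vertex x.color, x.level, x.side⟩ :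
      Flag W n M) = x
    rw [c.localAction_one]
    rfl
  mul_smul g h x := by
    change (⟨((g : T ≃g T) * h) x.vertex, c.localAction (g * h) x.vertex x.color, x.level, x.side⟩ :
      Flag W n M) = ⟨_, _, _, _⟩
    rw [c.localAction_mul]
    rfl

/-- Reverse an edge at the last level. -/
noncomputable def turn (y : Fin (M + 1)) (v : W) (i : Fin n) : W :=
  if y = Fin.last M then c.nb v i else v

theorem turn_turn (hc : c.IsLegal) (y : Fin (M + 1)) (v : W) (i : Fin n) :
    turn c y (turn c y v i) i = v := by
  unfold turn
  split_ifs
  · exact c.nb_nb hc v i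
  · rfl

theorem apply_turn (g : T ≃g T) (y : Fin (M + 1)) (v : W) (i : Fin n) :
    g (turn c y v i) = turn c y (g v) (c.localAction g v i) := by
  unfold turn
  split_ifs
  · exact c.apply_nb g v i
  · rfl

theorem localAction_turn (hc : c.IsLegal) (g : T ≃g T) (y : Fin (M + 1)) (v : W) (i : Fin n) :
    c.localAction g (turn c y v i) i = c.localAction g v i := by
  unfold turn
  split_ifs
  · exact c.localAction_nb hc g v i
  · rfl

variable (a : Fin d) (R : Fin (M + 1) → Fin d → Equiv.Perm (Fin n))

/-- The involutions on flags: the color `a` moves between levels, and the other colors move inside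
a level. -/
noncomputable def move (j : Fin d) : Flag W n M → Flag W n M
  | ⟨v, i, y, false⟩ =>
    if j = a then ⟨turn c ((finRotate _).symm y) v i, i, (finRotate _).symm y, true⟩
    else ⟨v, R y j i, y, true⟩
  | ⟨v, i, y, true⟩ =>
    if j = a then ⟨turn c y v i, i, finRotate _ y, false⟩ else ⟨v, (R y j).symm i, y, false⟩

theorem move_move (hc : c.IsLegal) (j : Fin d) (x : Flag W n M) :
    move c a R j (move c a R j x) = x := by
  obtain ⟨v, i, y, _ | _⟩ := x <;> by_cases h : j = a <;> simp [move, h, turn_turn c hc]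

/-- `hR` makes all edges at one vertex reachable from each other at level 0, hence at all levels
since the permutations are bijective. At the last level color `a` then passes to every neighbouring
vertex. -/
theorem move_connected (hT : T.IsTree) {S : Set (Flag W n M)} (hS : S.Nonempty)
    (hc : c.IsLegal) (hmove : ∀ j, ∀ x ∈ S, move c a R j x ∈ S) {o o' : Fin d} (ho : o ≠ a)
    (ho' : o' ≠ a)
    (hR : ∀ S : ℕ → Set (Fin n),
      (∀ y : Fin (M + 1), (y : ℕ) < M → ∀ i, i ∈ S y ↔ R y o i ∈ S (y + 1)) →
      (∀ y : Fin (M + 1), ∀ i ∈ S y, ((R y o)⁻¹ * R y o') i ∈ S y) →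
      (S 0).Nonempty → S 0 = Set.univ) : S = Set.univ := by
  have hiff : ∀ j x, x ∈ S ↔ move c a R j x ∈ S := fun j x => ⟨hmove j x, fun h => by
    have := hmove j _ h
    rwa [move_move c a R hc] at this⟩
  have hstep : ∀ (v : W) (i : Fin n) (y : Fin (M + 1)) (j : Fin d), j ≠ a →
      ((⟨v, i, y, false⟩ : Flag W n M) ∈ S ↔ (⟨v, R y j i, y, true⟩ : Flag W n M) ∈ S) := by
    intro v i y j hj
    rw [hiff j]
    simp [move, hj]
  have hturn : ∀ (v : W) (i : Fin n) (y : Fin (M + 1)), (⟨v, i, y, true⟩ : Flag W n M) ∈ S ↔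
      (⟨turn c y v i, i, finRotate _ y, false⟩ : Flag W n M) ∈ S := by
    intro v i y
    rw [hiff a]
    simp [move]
  have hup : ∀ (v : W) (i : Fin n) (k : ℕ) (hk : k < M),
      (⟨v, i, ⟨k, by omega⟩, false⟩ : Flag W n M) ∈ S ↔
      (⟨v, R ⟨k, by omega⟩ o i, ⟨k + 1, by omega⟩, false⟩ : Flag W n M) ∈ S := by
    intro v i k hk
    rw [hstep v i _ o ho, hturn, finRotate_of_lt hk, turn, if_neg]
    rw [Fin.ext_iff, Fin.val_last]
    exact hk.ne
  let A : W → ℕ → Set (Fin n) := fun v k =>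
    {i | ∃ hk : k < M + 1, (⟨v, i, ⟨k, hk⟩, false⟩ : Flag W n M) ∈ S}
  have hA : ∀ (v : W) (y : Fin (M + 1)) i, i ∈ A v y ↔ (⟨v, i, y, false⟩ : Flag W n M) ∈ S :=
    fun v y i => ⟨fun ⟨_, h⟩ => h, fun h => ⟨y.2, h⟩⟩
  have hzero : ∀ v, (A v 0).Nonempty → A v 0 = Set.univ := by
    refine fun v => hR (A v) (fun y hy i => ?_) fun y i hi => ?_
    · rw [hA, hup v i y hy]
      exact ⟨fun h => ⟨by omega, h⟩, fun ⟨_, h⟩ => h⟩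
    -- Color `o'` leads to the other side of the level and color `o` leads back.
    · rw [hA] at hi ⊢
      rw [hstep v _ y o ho]
      rw [hstep v i y o' ho'] at hi
      simpa using hi
  have hdown : ∀ v k i (hk : k < M + 1), (⟨v, i, ⟨k, hk⟩, false⟩ : Flag W n M) ∈ S →
      (A v 0).Nonempty := by
    intro v k
    induction k with
    | zero => exact fun i hk h => ⟨i, hk, h⟩
    | succ k ih =>
      intro i hk h
      refine ih ((R ⟨k, by omega⟩ o).symm i) (by omega) ?_
      rw [hup v _ k (by omega), Equiv.apply_symm_apply]
      exact h
  have hlevel : ∀ v, A v 0 = Set.univ → ∀ k i (hk : k < M + 1),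
      (⟨v, i, ⟨k, hk⟩, false⟩ : Flag W n M) ∈ S := by
    intro v hv k
    induction k with
    | zero =>
      intro i hk
      exact (hA v ⟨0, hk⟩ i).1 (hv ▸ Set.mem_univ i)
    | succ k ih =>
      intro i hk
      have := (hup v ((R ⟨k, by omega⟩ o).symm i) k (by omega)).1 (ih _ (by omega))
      rwa [Equiv.apply_symm_apply] at this
  have htrue : ∀ v, A v 0 = Set.univ → ∀ i y, (⟨v, i, y, true⟩ : Flag W n M) ∈ S := by
    intro v hv i y
    have := (hstep v ((R y o).symm i) y o ho).1 (hlevel v hv y _ y.2)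
    rwa [Equiv.apply_symm_apply] at this
  obtain ⟨v₀, hv₀⟩ : ∃ v, A v 0 = Set.univ := by
    obtain ⟨⟨v, i, y, _ | _⟩, hx⟩ := hS
    · exact ⟨v, hzero v (hdown v y i y.2 hx)⟩
    · refine ⟨v, hzero v (hdown v y ((R y o).symm i) y.2 ?_)⟩
      refine (hstep v _ y o ho).2 ?_
      rw [Equiv.apply_symm_apply]
      exact hx
  have hall : ∀ v, A v 0 = Set.univ := by
    refine forall_of_adj hT.connected v₀ hv₀ fun v w hvw hv => hzero w ?_
    obtain ⟨i, rfl⟩ := c.exists_nb hvw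
    have h1 := (hturn v i (Fin.last M)).1 (htrue v hv i _)
    rw [turn, if_pos rfl, finRotate_last] at h1
    exact ⟨i, Nat.succ_pos M, h1⟩
  refine Set.eq_univ_of_forall ?_
  rintro ⟨v, i, y, _ | _⟩
  · exact hlevel v (hall v) y i y.2
  · exact htrue v (hall v) i y

end Flag

/-- The action of `U(F')⁺` on flags, with its cocycle. -/
theorem exists_cocycleAction {W : Type u} {T : SimpleGraph W} {n d : ℕ} {c : RegularColoring T n}
    (hT : T.IsTree) (hc : c.IsLegal) {F' : Subgroup (Equiv.Perm (Fin n))} (hF' : IsAdmissible F')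
    {F : Subgroup (Equiv.Perm (Fin d))} {σ : Equiv.Perm (Fin d)} (hσF : σ ∈ F)
    (K : KernelData F' σ) (hσ : (orderOf σ).Prime) {a o : Fin d} (ha : σ a = a) (ho : σ o ≠ o) :
    ∃ (X : Type u) (_ : MulAction (plus (universalGroup c F')) X),
      Nonempty (CocycleAction (plus (universalGroup c F')) X F) := by
  obtain ⟨M, ζ, hζ, hseq⟩ := K.exists_sequence
  choose R hRo hR using fun y : Fin (M + 1) => K.exists_equivariant hσ ho (hζ y)
  let act : MulAction (plus (universalGroup c F')) (Flag W n M) := Flag.mulAction c _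
  have hU : ∀ (g : plus (universalGroup c F')) v, c.localAction (g : T ≃g T) v ∈ F' :=
    fun g => plus_le _ g.2
  have hsmul : ∀ (g : plus (universalGroup c F')) (x : Flag W n M), g • x =
    ⟨(g : T ≃g T) x.vertex, c.localAction g x.vertex x.color, x.level, x.side⟩ := fun _ _ => rfl
  have hRχ : ∀ y f j i, f ∈ F' → R y (K.χ' f j) (f i) = f (R y j i) := by
    intro y f j i hf
    rw [K.χ'_apply hf, hR]
    simp
  have hχa : ∀ f j, K.χ' f j = a ↔ j = a := fun f j => by
    conv_lhs => rw [← K.χ'_fix ha f]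
    exact (K.χ' f).injective.eq_iff
  have hoa : o ≠ a := by
    rintro rfl
    exact ho ha
  have hoa' : σ o ≠ a := fun h => hoa (σ.injective (h.trans ha.symm))
  have hn : 0 < n := by
    have := hF'.three_le
    omega
  obtain ⟨v₀⟩ := hT.connected.nonempty
  have heval : ∀ (g : plus (universalGroup c F')) v,
      ∀ᶠ h : plus (universalGroup c F') in 𝓝 g, (h : T ≃g T) v = (g : T ≃g T) v := fun g v =>
    continuous_subtype_val.continuousAt.eventually (eventually_apply_eq (g : T ≃g T) v)
  have hloc : ∀ (g : plus (universalGroup c F')) v, ∀ᶠ h : plus (universalGroup c F') in 𝓝 g,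
      c.localAction (h : T ≃g T) v = c.localAction (g : T ≃g T) v := fun g v =>
    continuous_subtype_val.continuousAt.eventually
      ((IsLocallyConstant.iff_eventually_eq _).1 (isLocallyConstant_localAction c v) (g : T ≃g T))
  let x₀ : W → Flag W n M := fun v => ⟨v, ⟨0, hn⟩, 0, false⟩
  refine ⟨Flag W n M, act, ⟨{
    ι := Flag.move c a R
    s := fun g x => K.χ' (c.localAction g x.vertex)
    nonempty := ⟨x₀ v₀⟩
    involutive := Flag.move_move c a R hc
    cocycle := ?_
    s_mem := fun g x => (Subgroup.zpowers_le.2 hσF) (K.χ'_mem _)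
    smul_ι := ?_
    s_ι := ?_
    connected := ?_
    faithful := ?_
    eventually_smul := ?_
    eventually_s := ?_
    le_nhds := ?_
    complete := ?_
    finite_orbits := ?_ }⟩⟩
  · intro g h x
    rw [hsmul, ← K.χ'_mul (hU g _) (hU h _), ← c.localAction_mul]
    rfl
  -- Color `a` is fixed by every power of σ and commutes with the action because edge reversal does;
  -- the other colors use the equivariance of `R`.
  · rintro g j ⟨v, i, y, _ | _⟩ <;> rw [hsmul, hsmul] <;> by_cases hj : j = a
    · subst hj
      simp [Flag.move, K.χ'_fix ha, Flag.apply_turn, Flag.localAction_turn c hc]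
    · have hj' : K.χ' (c.localAction (g : T ≃g T) v) j ≠ a := fun h => hj ((hχa _ _).1 h)
      simp [Flag.move, hj, hj', hRχ _ _ _ _ (hU g v)]
    · subst hj
      simp [Flag.move, K.χ'_fix ha, Flag.apply_turn, Flag.localAction_turn c hc]
    · have hj' : K.χ' (c.localAction (g : T ≃g T) v) j ≠ a := fun h => hj ((hχa _ _).1 h)
      simp only [Flag.move, hj, hj', if_false]
      congr 1
      rw [eq_comm, Equiv.symm_apply_eq, hRχ _ _ _ _ (hU g v), Equiv.apply_symm_apply]
  · rintro g j ⟨v, i, y, _ | _⟩ <;> by_cases hj : j = a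
    · subst hj
      simp [K.χ'_fix ha]
    · simp [Flag.move, hj]
    · subst hj
      simp [K.χ'_fix ha]
    · simp [Flag.move, hj]
  · intro S hS hmove
    refine Flag.move_connected c a R hT hS hc hmove hoa hoa' fun A h1 h2 h3 => hseq A ?_ ?_ h3
    · intro k hk i
      have := h1 ⟨k, by omega⟩ hk i
      rwa [hRo] at this
    · intro k hk i hi
      have h4 := h2 ⟨k, by omega⟩ i hi
      -- Since `K.gen` lies over σ, the permutation of color `σ o` is the conjugate by `K.gen` of
      -- that of color `o`.
      have h5 := hR ⟨k, by omega⟩ K.gen o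
      rw [K.χ_gen, hRo] at h5
      rw [h5, hRo] at h4
      exact h4
  · intro g h hgh
    refine Subtype.ext (RelIso.ext fun v => ?_)
    exact congrArg Flag.vertex (hgh (x₀ v))
  · intro g x
    filter_upwards [heval g x.vertex, hloc g x.vertex] with h h1 h2
    rw [hsmul, hsmul, h1, h2]
  · intro g x
    filter_upwards [hloc g x.vertex] with h h2
    rw [h2]
  · intro g
    rw [nhds_subtype, ← map_le_iff_le_comap]
    change Tendsto (fun h : plus (universalGroup c F') => (h : T ≃g T)) _ _
    refine tendsto_aut.2 fun v => ?_
    refine mem_of_superset (mem_iInf_of_mem (x₀ v) (mem_principal_self _)) fun h hh => ?_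
    exact congrArg Flag.vertex hh
  · intro l hl h1 h2
    obtain ⟨g, hg⟩ := exists_tendsto_aut (l := l)
      (φ := fun h : plus (universalGroup c F') => (h : T ≃g T))
      (fun v => by
        obtain ⟨x, hx⟩ := h1 (x₀ v)
        exact ⟨x.vertex, hx.mono fun h hh => congrArg Flag.vertex hh⟩)
      (fun v => by
        obtain ⟨x, hx⟩ := h2 (x₀ v)
        exact ⟨x.vertex, hx.mono fun h hh => congrArg Flag.vertex hh⟩)
    have hmem : g ∈ plus (universalGroup c F') :=
      (isClosed_plus (isClosed_universalGroup c F') (c.adj_nb v₀ ⟨0, hn⟩)).mem_of_tendsto hg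
        (Eventually.of_forall fun h => h.2)
    exact ⟨⟨g, hmem⟩, tendsto_subtype_rng.2 hg⟩
  · let w₀ := c.nb v₀ ⟨0, hn⟩
    refine ⟨Set.range fun z : Bool × Fin n × Fin (M + 1) × Bool =>
      (⟨if z.1 then v₀ else w₀, z.2.1, z.2.2.1, z.2.2.2⟩ : Flag W n M), Set.finite_range _, ?_⟩
    rintro ⟨v, i, y, b⟩
    obtain ⟨g, hg, ⟨h1, -⟩ | ⟨h1, -⟩⟩ := exists_move_dart hT hc hF' (c.adj_nb v₀ ⟨0, hn⟩)
      (c.adj_nb v i)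
    · refine ⟨⟨g, hg⟩, ⟨true, c.localAction g v i, y, b⟩, ?_⟩
      rw [hsmul]
      simp [h1]
    · refine ⟨⟨g, hg⟩, ⟨false, c.localAction g v i, y, b⟩, ?_⟩
      rw [hsmul]
      simp [h1, w₀]

/-- A universal group over a permutation group with a point stabilizer of order divisible by `p` has
a subquotient `U(F')⁺`. -/
theorem exists_isSimpleSubquotient_plus {V : Type*} {T : SimpleGraph V} (hT : T.IsTree) {d : ℕ}
    {c : RegularColoring T d} (hc : c.IsLegal) {F : Subgroup (Equiv.Perm (Fin d))} {p r : ℕ}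
    (hp : p.Prime) (hr : r.Prime) (hrp : r ≠ p)
    (hpF : ∃ i : Fin d, p ∣ Nat.card (MulAction.stabilizer F i))
    {n : ℕ} {F' : Subgroup (Equiv.Perm (Fin n))} (hF' : IsFrobenius F')
    (hcard : ∀ i : Fin n, Nat.card (MulAction.stabilizer F' i) = p)
    (hindex : ∀ i : Fin n, ∃ k : ℕ, (MulAction.stabilizer F' i).index = r ^ k)
    {W : Type*} {T' : SimpleGraph W} (hT' : T'.IsTree) {c' : RegularColoring T' n}
    (hc' : c'.IsLegal) :
    ∃ (H : Subgroup (T ≃g T)) (D : Subgroup H) (_ : D.Normal),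
      IsSimpleSubquotient (universalGroup c F) H D ∧
      Nonempty ((H ⧸ D) ≃ₜ* plus (universalGroup c' F')) := by
  obtain ⟨a, ha⟩ := hpF
  have := Fact.mk hp
  obtain ⟨⟨⟨σ, hσF⟩, hσa⟩, hσ⟩ := exists_prime_orderOf_dvd_card' p ha
  rw [Subgroup.orderOf_mk, Subgroup.orderOf_mk] at hσ
  obtain ⟨o, ho⟩ : ∃ o, σ o ≠ o := by
    by_contra! h
    have h1 : σ = 1 := Equiv.ext h
    rw [h1, orderOf_one] at hσ
    exact hp.one_lt.ne hσ
  obtain ⟨⟨K⟩, hadm⟩ := hF'.exists_kernelData hp hr hrp hcard hindex hσ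
  obtain ⟨X, _, ⟨E⟩⟩ := exists_cocycleAction (c := c') hT' hc' hadm hσF K (hσ ▸ hp)
    (a := a) (o := o) hσa ho
  obtain ⟨v₀⟩ := hT'.connected.nonempty
  have hclosed := isClosed_plus (isClosed_universalGroup c' F')
    (c'.adj_nb v₀ ⟨0, by have := hadm.three_le; omega⟩)
  have := locallyCompactSpace_aut hT'.connected c'.finite_neighborSet
  have : LocallyCompactSpace (plus (universalGroup c' F')) :=
    hclosed.isClosedEmbedding_subtypeVal.locallyCompactSpace
  have := isSimpleGroup_plus hT' hc' hadm
  exact E.exists_isSimpleSubquotient hT hc (not_discreteTopology_plus hT' hc' hadm)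

end BurgerMozes

namespace BurgerMozes

universe u

/-! ### Legal colorings and a model of the regular tree -/

section LegalColorings

/-- A regular tree of positive degree has a legal coloring. -/
theorem exists_legal_coloring {V : Type u} {T : SimpleGraph V} (hT : T.IsTree) {n : ℕ}
    (hn : n ≠ 0) (hreg : IsRegular T n) : ∃ c : RegularColoring T n, c.IsLegal := by
  classical
  obtain ⟨t⟩ := hT.connected.nonempty
  have hβ : ∀ v, Nonempty (T.neighborSet v ≃ Fin n) := fun v => by
    have hv : Nat.card (T.neighborSet v) ≠ 0 := by rwa [hreg v]
    exact ⟨(Nat.equivFinOfCardPos hv).trans (finCongr (hreg v))⟩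
  let β := fun v => (hβ v).some
  -- Each vertex starts with an arbitrary numbering `β` of its neighbours; the swap `τ` adjusts it
  -- so that the edge to the parent gets the color the parent gave it.
  obtain ⟨τ, -, hτ⟩ := exists_tree_rec hT t (1 : Equiv.Perm (Fin n)) (fun v w τ =>
    if h : T.Adj v w then Equiv.swap (β w ⟨v, h.symm⟩) (τ (β v ⟨w, h⟩)) else 1)
  have key : ∀ v w (h : T.Adj v w), T.dist w t = T.dist v t + 1 →
      τ w (β w ⟨v, h.symm⟩) = τ v (β v ⟨w, h⟩) := by
    intro v w h hd
    rw [hτ v w h hd, dif_pos h, Equiv.swap_apply_left]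
  refine ⟨⟨fun e => τ e.fst (β e.fst ⟨e.snd, e.adj⟩), fun v => ?_⟩, fun e => ?_⟩
  · exact ((β v).trans (τ v)).bijective
  · rcases dist_adj_cases hT t e.adj with hd | hd
    · exact (key e.snd e.fst e.adj.symm hd).symm
    · exact key e.fst e.snd e.adj hd

/-- Words without repetition of adjacent letters. -/
def ReducedWord (n : ℕ) : Type := {l : List (Fin n) // l.IsChain (· ≠ ·)}

/-- The regular tree of reduced words. -/
def wordTree (n : ℕ) : SimpleGraph (ReducedWord n) where
  Adj l l' := ∃ i, l'.1 = i :: l.1 ∨ l.1 = i :: l'.1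
  symm := ⟨fun _ _ ⟨i, h⟩ => ⟨i, h.symm⟩⟩
  loopless := ⟨fun l ⟨i, h⟩ => by
    have : l.1 = i :: l.1 := h.elim id id
    exact absurd (congrArg List.length this) (by simp)⟩

/-- Deleting first letters leads every word to the empty one. Each edge is a bridge: the words
ending in `l'` can only be entered through the edge that adds the first letter of `l'`. -/
theorem wordTree_isTree (n : ℕ) : (wordTree n).IsTree := by
  have hne : Nonempty (ReducedWord n) := ⟨⟨[], List.isChain_nil⟩⟩
  refine ⟨⟨fun l l' => ?_⟩, ?_⟩
  · have h0 : ∀ l : ReducedWord n, (wordTree n).Reachable l ⟨[], List.isChain_nil⟩ := by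
      rintro ⟨l, hl⟩
      induction l with
      | nil => exact SimpleGraph.Reachable.refl _
      | cons i l ih =>
        have hadj : (wordTree n).Adj ⟨i :: l, hl⟩ ⟨l, hl.tail⟩ := ⟨i, Or.inr rfl⟩
        exact hadj.reachable.trans (ih hl.tail)
    exact (h0 l).trans (h0 l').symm
  · rw [SimpleGraph.isAcyclic_iff_forall_adj_isBridge]
    have key : ∀ (l l' : ReducedWord n) (i : Fin n), l'.1 = i :: l.1 →
        (wordTree n).IsBridge s(l, l') := by
      intro l l' i hi
      rw [SimpleGraph.isBridge_iff_forall_walk_mem_edges]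
      intro p
      obtain ⟨e, he, h1, h2⟩ := p.exists_boundary_dart {x | ¬ l'.1 <:+ x.1}
        (fun h => by
          have := h.length_le
          rw [hi] at this
          simp at this)
        (by simp)
      simp only [Set.mem_ofPred_eq, not_not] at h1 h2
      obtain ⟨j, hj | hj⟩ := e.adj
      · rw [hj, List.suffix_cons_iff] at h2
        have h3 := h2.resolve_right h1
        have e2 : e.snd = l' := Subtype.ext (hj.trans h3.symm)
        have e1 : e.fst = l := by
          rw [hi, List.cons.injEq] at h3
          exact Subtype.ext h3.2.symm
        have : e.edge = s(l, l') := by rw [← e1, ← e2]; rfl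
        rw [← this]
        exact List.mem_map_of_mem he
      · exact absurd (h2.trans (hj ▸ List.suffix_cons j _)) h1
    rintro l l' ⟨i, h | h⟩
    · exact key l l' i h
    · rw [Sym2.eq_swap]
      exact key l' l i h

theorem wordTree_isRegular (n : ℕ) : IsRegular (wordTree n) n := by
  rintro ⟨l, hl⟩
  refine Eq.trans ?_ (Nat.card_fin n)
  symm
  cases l with
  | nil =>
    refine Nat.card_eq_of_bijective (fun i => ⟨⟨[i], List.isChain_singleton i⟩, i, Or.inl rfl⟩)
      ⟨fun i j h => ?_, ?_⟩
    · have : [i] = [j] := congrArg (fun x => x.1.1) h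
      simpa using this
    · rintro ⟨⟨l', hl'⟩, i, h | h⟩
      · exact ⟨i, Subtype.ext (Subtype.ext h.symm)⟩
      · simp at h
  | cons k l =>
    refine Nat.card_eq_of_bijective (fun i => if h : i = k then ⟨⟨l, hl.tail⟩, k, Or.inr rfl⟩
      else ⟨⟨i :: k :: l, List.isChain_cons_cons.2 ⟨h, hl⟩⟩, i, Or.inl rfl⟩) ⟨fun i j h => ?_, ?_⟩
    · have h' := congrArg (fun x => x.1.1) h
      by_cases hi : i = k <;> by_cases hj : j = k
      · rw [hi, hj]
      · simp only [hi, hj, dif_pos, dif_neg, not_false_eq_true] at h'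
        exact absurd (congrArg List.length h') (by simp; omega)
      · simp only [hi, hj, dif_pos, dif_neg, not_false_eq_true] at h'
        exact absurd (congrArg List.length h') (by simp; omega)
      · simp only [hi, hj, dif_neg, not_false_eq_true] at h'
        exact (List.cons.inj h').1
    · rintro ⟨⟨l', hl'⟩, i, h | h⟩
      · have h' : l' = i :: k :: l := h
        subst h'
        have hik : i ≠ k := (List.isChain_cons_cons.1 hl').1
        exact ⟨i, by simp [hik]⟩
      · have h' : l' = l := ((List.cons.inj h).2).symm
        subst h'
        exact ⟨k, by simp⟩

end LegalColorings

/-! ### Examples of Frobenius groups -/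

section Examples

open MulAction

theorem universalGroup_top {V : Type u} {T : SimpleGraph V} {n : ℕ} (c : RegularColoring T n) :
    universalGroup c ⊤ = ⊤ :=
  eq_top_iff.2 fun _ _ _ => Subgroup.mem_top _

theorem top_isPretransitive (n : ℕ) :
    IsPretransitive (⊤ : Subgroup (Equiv.Perm (Fin n))) (Fin n) :=
  ⟨fun i j => ⟨⟨Equiv.swap i j, Subgroup.mem_top _⟩, Equiv.swap_apply_left i j⟩⟩

theorem top_three_index (i : Fin 3) :
    (stabilizer (⊤ : Subgroup (Equiv.Perm (Fin 3))) i).index = 3 := by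
  have := top_isPretransitive 3
  rw [index_stabilizer_of_transitive, Nat.card_fin]

theorem top_three_card (i : Fin 3) :
    Nat.card (stabilizer (⊤ : Subgroup (Equiv.Perm (Fin 3))) i) = 2 := by
  have h := (stabilizer (⊤ : Subgroup (Equiv.Perm (Fin 3))) i).card_mul_index
  rw [top_three_index, Subgroup.card_top, Nat.card_perm, Nat.card_fin] at h
  have h6 : Nat.factorial 3 = 6 := rfl
  omega

theorem not_actsFreely_of_card {n : ℕ} {F : Subgroup (Equiv.Perm (Fin n))} (i : Fin n)
    (h : Nat.card (stabilizer F i) ≠ 1) : ¬ ActsFreely F := fun hfree => by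
  rw [hfree i, Subgroup.card_bot] at h
  exact h rfl

theorem isFrobenius_top_three : IsFrobenius (⊤ : Subgroup (Equiv.Perm (Fin 3))) where
  transitive := top_isPretransitive 3
  not_free := not_actsFreely_of_card 0 (by rw [top_three_card]; decide)
  two_point i j hij := by
    refine (Subgroup.eq_bot_iff_forall _).2 fun f hf => Subtype.ext ?_
    have h : ∀ (i j : Fin 3) (f : Equiv.Perm (Fin 3)), i ≠ j → f i = i → f j = j → f = 1 := by
      decide
    exact h i j f hij hf.1 hf.2

variable {r : ℕ} [Fact r.Prime]

/-- The group of affine permutations of `ZMod r` with multipliers in the group generated by `u₀`,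
acting on `Fin r`. -/
def affineGroup (ε : ZMod r ≃ Fin r) (u₀ : (ZMod r)ˣ) : Subgroup (Equiv.Perm (Fin r)) where
  carrier := {f | ∃ u ∈ Subgroup.zpowers u₀, ∃ b : ZMod r, ∀ x, f (ε x) = ε (u * x + b)}
  one_mem' := ⟨1, one_mem _, 0, fun x => by simp⟩
  mul_mem' := by
    rintro f f' ⟨u, hu, b, h⟩ ⟨u', hu', b', h'⟩
    refine ⟨u * u', mul_mem hu hu', u * b' + b, fun x => ?_⟩
    rw [Equiv.Perm.mul_apply, h', h]
    congr 1
    push_cast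
    ring
  inv_mem' := by
    rintro f ⟨u, hu, b, h⟩
    refine ⟨u⁻¹, inv_mem hu, -(u⁻¹ * b : ZMod r), fun x => ?_⟩
    rw [Equiv.Perm.inv_eq_iff_eq, h]
    congr 1
    rw [mul_add, mul_neg, Units.mul_inv_cancel_left, Units.mul_inv_cancel_left]
    ring

theorem exists_affine (ε : ZMod r ≃ Fin r) {u₀ u : (ZMod r)ˣ} (hu : u ∈ Subgroup.zpowers u₀)
    (b : ZMod r) : ∃ f : affineGroup ε u₀, ∀ x, (f : Equiv.Perm (Fin r)) (ε x) = ε (u * x + b) :=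
  ⟨⟨ε.symm.trans ((u.mulLeft.trans (Equiv.addRight b)).trans ε), u, hu, b, fun x => by simp⟩,
    fun x => by simp⟩

theorem affineGroup_isPretransitive (ε : ZMod r ≃ Fin r) (u₀ : (ZMod r)ˣ) :
    IsPretransitive (affineGroup ε u₀) (Fin r) := by
  refine ⟨fun i j => ?_⟩
  obtain ⟨f, hf⟩ := exists_affine ε (one_mem (Subgroup.zpowers u₀)) (ε.symm j - ε.symm i)
  refine ⟨f, ?_⟩
  have := hf (ε.symm i)
  rw [Equiv.apply_symm_apply] at this
  rw [perm_smul_def, this]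
  simp

theorem affineGroup_eq_one (ε : ZMod r ≃ Fin r) {u₀ : (ZMod r)ˣ} {f : Equiv.Perm (Fin r)}
    (hf : f ∈ affineGroup ε u₀) {i j : Fin r} (hij : i ≠ j) (hi : f i = i) (hj : f j = j) :
    f = 1 := by
  obtain ⟨u, hu, b, h⟩ := hf
  obtain ⟨x, rfl⟩ := ε.surjective i
  obtain ⟨y, rfl⟩ := ε.surjective j
  have hxy : x - y ≠ 0 := sub_ne_zero.2 fun h => hij (congrArg ε h)
  have hx := ε.injective ((h x).symm.trans hi)
  have hy := ε.injective ((h y).symm.trans hj)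
  have hu1 : (u : ZMod r) = 1 := by
    refine mul_right_cancel₀ hxy ?_
    linear_combination hx - hy
  have hb : b = 0 := by
    rw [hu1] at hx
    linear_combination hx
  refine Equiv.ext fun k => ?_
  obtain ⟨z, rfl⟩ := ε.surjective k
  rw [h, hu1, hb]
  simp

/-- An affine map fixing a point is determined by its multiplier, and every multiplier in the group
occurs. -/
theorem affineGroup_card (ε : ZMod r ≃ Fin r) (u₀ : (ZMod r)ˣ) (i : Fin r) :
    Nat.card (stabilizer (affineGroup ε u₀) i) = orderOf u₀ := by
  obtain ⟨z, rfl⟩ := ε.surjective i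
  rw [← Nat.card_zpowers]
  symm
  choose f hf using fun u : Subgroup.zpowers u₀ => exists_affine ε u.2 (z - ((u : (ZMod r)ˣ) : ZMod r) * z)
  have hfix : ∀ u, f u ∈ stabilizer (affineGroup ε u₀) (ε z) := fun u => by
    rw [mem_stabilizer_iff, perm_smul_def, hf]
    simp
  refine Nat.card_eq_of_bijective (fun u => ⟨f u, hfix u⟩) ⟨fun u u' h => ?_, ?_⟩
  · have h1 : f u = f u' := congrArg Subtype.val h
    have h2 := hf u (z + 1)
    rw [h1, hf u'] at h2
    have h3 := ε.injective h2
    refine Subtype.ext (Units.ext ?_)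
    linear_combination -h3
  · rintro ⟨⟨g, hg⟩, hgz⟩
    obtain ⟨u, hu, b, h⟩ := hg
    refine ⟨⟨u, hu⟩, Subtype.ext (Subtype.ext (Equiv.ext fun k => ?_))⟩
    obtain ⟨x, rfl⟩ := ε.surjective k
    have hz : g (ε z) = ε z := hgz
    rw [h] at hz
    have hz' := ε.injective hz
    change (f ⟨u, hu⟩ : Equiv.Perm (Fin r)) (ε x) = g (ε x)
    rw [hf, h]
    congr 1
    linear_combination -hz'

/-- For every prime `p` there is a Frobenius group with point stabilizers of order `p` and of prime
index different from `p`. -/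
theorem exists_isFrobenius {p : ℕ} (hp : p.Prime) :
    ∃ r : ℕ, r.Prime ∧ r ≠ p ∧ ∃ F : Subgroup (Equiv.Perm (Fin r)), IsFrobenius F ∧
      (∀ i : Fin r, Nat.card (stabilizer F i) = p) ∧
      ∀ i : Fin r, ∃ k : ℕ, (stabilizer F i).index = r ^ k := by
  -- A prime `r` congruent to 1 modulo `p` provides a multiplier of order `p` in the units of `ZMod
  -- r`.
  obtain ⟨r, hr, hpr, hmod⟩ := Nat.exists_prime_gt_modEq_one p hp.ne_zero
  have := Fact.mk hr
  have := Fact.mk hp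
  have hdvd : p ∣ Nat.card (ZMod r)ˣ := by
    rw [Nat.card_eq_fintype_card, ZMod.card_units]
    exact (Nat.modEq_iff_dvd' hr.one_le).1 hmod.symm
  obtain ⟨u₀, hu₀⟩ := exists_prime_orderOf_dvd_card' p hdvd
  let ε : ZMod r ≃ Fin r := (ZMod.finEquiv r).symm.toEquiv
  have hcard : ∀ i : Fin r, Nat.card (stabilizer (affineGroup ε u₀) i) = p := fun i => by
    rw [affineGroup_card, hu₀]
  have htrans := affineGroup_isPretransitive ε u₀
  refine ⟨r, hr, hpr.ne', affineGroup ε u₀, ⟨htrans, ?_, fun i j hij => ?_⟩, hcard, fun i => ⟨1, ?_⟩⟩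
  · refine not_actsFreely_of_card ⟨0, hr.pos⟩ ?_
    rw [hcard]
    exact hp.one_lt.ne'
  · exact (Subgroup.eq_bot_iff_forall _).2 fun f hf =>
      Subtype.ext (affineGroup_eq_one ε f.2 hij hf.1 hf.2)
  · rw [index_stabilizer_of_transitive, Nat.card_fin, pow_one]

end Examples

/-- The case of a point stabilizer of even order. -/
theorem exists_isSimpleSubquotient_three {V : Type*} {T : SimpleGraph V} (hT : T.IsTree) {d : ℕ}
    {c : RegularColoring T d} (hc : c.IsLegal) {F : Subgroup (Equiv.Perm (Fin d))}
    (hF : ∃ i : Fin d, 2 ∣ Nat.card (MulAction.stabilizer F i))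
    {W : Type*} (T₃ : SimpleGraph W) (hT₃ : T₃.IsTree) (hreg : IsRegular T₃ 3) :
    ∃ (H : Subgroup (T ≃g T)) (D : Subgroup H) (_ : D.Normal),
      IsSimpleSubquotient (universalGroup c F) H D ∧
      Nonempty ((H ⧸ D) ≃ₜ* plus (⊤ : Subgroup (T₃ ≃g T₃))) := by
  -- Sym(3) is Frobenius with stabilizers of order 2 and index 3, and its universal group is the
  -- whole automorphism group.
  obtain ⟨c', hc'⟩ := exists_legal_coloring hT₃ three_ne_zero hreg
  have := exists_isSimpleSubquotient_plus hT hc Nat.prime_two Nat.prime_three (by decide) hF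
    isFrobenius_top_three top_three_card (fun i => ⟨1, top_three_index i⟩) hT₃ hc'
  rwa [universalGroup_top] at this

end BurgerMozes

/-! ### The main theorem -/

theorem mainTheorem8 {V : Type*} (T : SimpleGraph V) (hT : T.IsTree) {d : ℕ}
    (c : BurgerMozes.RegularColoring T d) (hc : c.IsLegal)
    (F : Subgroup (Equiv.Perm (Fin d))) (hF : ¬ BurgerMozes.ActsFreely F) :
    -- a subquotient in the class `𝒮`, of the form `Aut(T₃)⁺` or `U(F')⁺` with `F'` Frobenius
    (∃ (H : Subgroup (T ≃g T)) (D : Subgroup H) (_ : D.Normal),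
      BurgerMozes.IsSimpleSubquotient (BurgerMozes.universalGroup c F) H D ∧
      ((∃ (W : Type) (T₃ : SimpleGraph W), T₃.IsTree ∧ BurgerMozes.IsRegular T₃ 3 ∧
          Nonempty ((H ⧸ D) ≃ₜ* BurgerMozes.plus (⊤ : Subgroup (T₃ ≃g T₃)))) ∨
        ∃ (n : ℕ) (F' : Subgroup (Equiv.Perm (Fin n))) (W : Type) (T' : SimpleGraph W)
          (c' : BurgerMozes.RegularColoring T' n),
          BurgerMozes.IsFrobenius F' ∧ T'.IsTree ∧ c'.IsLegal ∧
          Nonempty ((H ⧸ D) ≃ₜ* BurgerMozes.plus (BurgerMozes.universalGroup c' F')))) ∧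
    -- the prime 2
    ((∃ i : Fin d, 2 ∣ Nat.card (MulAction.stabilizer F i)) →
      ∀ {W : Type*} (T₃ : SimpleGraph W), T₃.IsTree → BurgerMozes.IsRegular T₃ 3 →
      ∃ (H : Subgroup (T ≃g T)) (D : Subgroup H) (_ : D.Normal),
        BurgerMozes.IsSimpleSubquotient (BurgerMozes.universalGroup c F) H D ∧
        Nonempty ((H ⧸ D) ≃ₜ* BurgerMozes.plus (⊤ : Subgroup (T₃ ≃g T₃)))) ∧
    -- the odd primes
    (∀ p : ℕ, p.Prime → 2 < p → (∃ i : Fin d, p ∣ Nat.card (MulAction.stabilizer F i)) →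
      ∀ {n : ℕ} (F' : Subgroup (Equiv.Perm (Fin n))), BurgerMozes.IsFrobenius F' →
      (∀ i : Fin n, Nat.card (MulAction.stabilizer F' i) = p) →
      (∀ i : Fin n, ∃ k : ℕ, (MulAction.stabilizer F' i).index = 2 ^ k) →
      ∀ {W : Type*} (T' : SimpleGraph W), T'.IsTree →
      ∀ c' : BurgerMozes.RegularColoring T' n, c'.IsLegal →
      ∃ (H : Subgroup (T ≃g T)) (D : Subgroup H) (_ : D.Normal),
        BurgerMozes.IsSimpleSubquotient (BurgerMozes.universalGroup c F) H D ∧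
        Nonempty ((H ⧸ D) ≃ₜ* BurgerMozes.plus (BurgerMozes.universalGroup c' F'))) := by
  refine ⟨?_, ?_, ?_⟩
  · obtain ⟨i, hi⟩ := not_forall.1 hF
    have hcard : Nat.card (MulAction.stabilizer F i) ≠ 1 := fun h =>
      hi (Subgroup.card_eq_one.1 h)
    obtain ⟨p, hp, hpi⟩ := Nat.exists_prime_and_dvd hcard
    by_cases hp2 : p = 2
    · subst hp2
      obtain ⟨H, D, hD, h, e⟩ := BurgerMozes.exists_isSimpleSubquotient_three hT hc ⟨i, hpi⟩
        (BurgerMozes.wordTree 3) (BurgerMozes.wordTree_isTree 3) (BurgerMozes.wordTree_isRegular 3)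
      exact ⟨H, D, hD, h, Or.inl ⟨_, BurgerMozes.wordTree 3, BurgerMozes.wordTree_isTree 3,
        BurgerMozes.wordTree_isRegular 3, e⟩⟩
    -- Any Frobenius group with complements of order `p` will do here, so the affine one of prime
    -- degree `r` serves.
    · obtain ⟨r, hr, hrp, F', hF', hcard', hindex⟩ := BurgerMozes.exists_isFrobenius hp
      obtain ⟨c', hc'⟩ := BurgerMozes.exists_legal_coloring (BurgerMozes.wordTree_isTree r)
        hr.ne_zero (BurgerMozes.wordTree_isRegular r)
      obtain ⟨H, D, hD, h, e⟩ := BurgerMozes.exists_isSimpleSubquotient_plus hT hc hp hr hrp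
        ⟨i, hpi⟩ hF' hcard' hindex (BurgerMozes.wordTree_isTree r) hc'
      exact ⟨H, D, hD, h, Or.inr ⟨r, F', _, BurgerMozes.wordTree r, c', hF',
        BurgerMozes.wordTree_isTree r, hc', e⟩⟩
  · intro h2 W T₃ hT₃ hreg
    exact BurgerMozes.exists_isSimpleSubquotient_three hT hc h2 T₃ hT₃ hreg
  · intro p hp hp2 hpi n F' hF' hcard hindex W T' hT' c' hc'
    exact BurgerMozes.exists_isSimpleSubquotient_plus hT hc hp Nat.prime_two hp2.ne hpi hF' hcard
      hindex hT' hc'
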